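/- Let $q$ be even, let $n\ge 2$, and let $\mathcal P=\mathcal Q(2n,q)$ be a nonsingular parabolic quadric in $\mathrm{PG}(2n,q)$ with nucleus $N$ (the point $N\notin\mathcal P$ such that every line through $N$ meets $\mathcal P$ in exactly one point). Let $\pi$ be a singular hyperplane of $\mathcal P$ with vertex $P$, that is, $\pi\cap\mathcal P$ is a cone with vertex the point $P$ and base a nonsingular parabolic quadric in a hyperplane of $\pi$ not through $P$. Notation: $\mathcal Q^+$, $\mathcal Q^-$, $\mathcal Q$ denote nonsingular hyperbolic, elliptic and parabolic quadrics, and $P\mathcal C$ denotes the cone with vertex a point $P$ and base $\mathcal C$. A parabolic quasi-quadric in $\mathrm{PG}(2n,q)$ is a set of points that meets every hyperplane in $|\mathcal Q^-(2n-1,q)|$, $|P\mathcal Q(2n-2,q)|$ or $|\mathcal Q^+(2n-1,q)|$ points. A set $\mathcal P'$ is obtained from $\mathcal P$ by switching in $\pi$ if $\mathcal P'=(\mathcal P\setminus R)\cup R'$ for some sets $R,R'$ of points of $\pi$. A truncated line through a point $C$ is the set of points of a line through $C$, except $C$ itself. (1) Suppose that $\mathcal P'$ is a parabolic quasi-quadric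 with $|\mathcal P'|=|\mathcal Q(2n,q)|$, obtained from $\mathcal P$ by switching in $\pi$. Then $\mathcal P'\cap\pi$ is the union of $\frac{q^{2n-2}-1}{q-1}$ truncated lines of $\pi$, each through $P$ or through $N$, to which either all points of the line $PN$ (in which case $PN$, truncated at $P$ or at $N$, is one of these truncated lines), or exactly one of the points $P$ and $N$ (in which case the other one is not in $\mathcal P'$) is added. The only points lying on more than one of these truncated lines are possibly $P$ and $N$. Furthermore, every hyperplane of $\pi$ through $P$ or $N$ meets $\mathcal P'$ in $|P\mathcal Q^-(2n-3,q)|$, $|\mathcal Q(2n-2,q)|$ or $|P\mathcal Q^+(2n-3,q)|$ points. (2) Conversely, take any set of $\frac{q^{2n-2}-1}{q-1}$ truncated lines of $\pi$, each through $P$ or through $N$, such that the only points lying on more than one of them are possibly $P$ and $N$. Let $\mathcal S$ be the union of these truncated lines to which either all points of the line $PN$, or the point $P$, or the point $N$ is added. If every hyperplane of $\pi$ through $P$ or $N$ meets $\mathcal S$ in $|P\mathcal Q^-(2n-3,q)|$, $|\mathcal Q(2n-2,q)|$ or $|P\mathcal Q^+(2n-3,q)|$ points, then $(\mathcal P\setminus\pi)\cup\mathcal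 S$ is a parabolic quasi-quadric. -/

import Mathlib

open scoped LinearAlgebra.Projectivization

/-- The points of `PG(V)` lying in the projective subspace given by the vector subspace `W`. -/
def pts {K V : Type*} [Field K] [AddCommGroup V] [Module K V] (W : Submodule K V) :
    Set (ℙ K V) :=
  {X | X.submodule ≤ W}

/-- The projective line through the points `X` and `Y` (which are distinct in all uses where the
result has to be a line), as a vector subspace. -/
def lineThrough {K V : Type*} [Field K] [AddCommGroup V] [Module K V] (X Y : ℙ K V) :
    Submodule K V :=
  X.submodule ⊔ Y.submodule

/-- `ν` is a hyperplane of the (projective) subspace `W`. -/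
def IsHyperplaneOf {K V : Type*} [Field K] [AddCommGroup V] [Module K V]
    (ν W : Submodule K V) : Prop :=
  ν ≤ W ∧ Module.finrank K ν + 1 = Module.finrank K W

/-- The point set of the quadric with equation `Q = 0`. -/
def quadric {K V : Type*} [Field K] [AddCommGroup V] [Module K V] (Q : QuadraticForm K V) :
    Set (ℙ K V) :=
  {X | Q X.rep = 0}

/-- Membership in a quadric may be tested on any representative vector. -/
theorem mk_mem_quadric {K V : Type*} [Field K] [AddCommGroup V] [Module K V]
    (Q : QuadraticForm K V) (v : V) (hv : v ≠ 0) :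
    Projectivization.mk K v hv ∈ quadric Q ↔ Q v = 0 := by
  obtain ⟨a, ha⟩ := Projectivization.exists_smul_eq_mk_rep K v hv
  have ha0 : (a : K) ≠ 0 := a.ne_zero
  simp [quadric, ← ha, Units.smul_def, QuadraticMap.map_smul, ha0]

/-- A quadratic form is nonsingular if its quadric has no singular point, i.e. no nonzero vector
with `Q v = 0` lies in the radical of the polar form. In odd vector space dimension `2n+1` the
quadrics of these forms are the parabolic quadrics `Q(2n,q)`. -/
def IsNonsingularForm {K V : Type*} [Field K] [AddCommGroup V] [Module K V]
    (Q : QuadraticForm K V) : Prop :=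
  ∀ v : V, v ≠ 0 → Q v = 0 → ∃ w : V, QuadraticMap.polar Q v w ≠ 0

/-- Over a finite field there is an anisotropic binary form `x² + xy + dy²`. -/
theorem exists_anisotropic_coeff (K : Type*) [Field K] [Finite K] :
    ∃ d : K, ∀ x : K, x ^ 2 + x + d ≠ 0 := by
  by_contra! h
  have hsurj : Function.Surjective (fun x : K => x ^ 2 + x) := by
    intro y
    obtain ⟨x, hx⟩ := h (-y)
    exact ⟨x, by linear_combination hx⟩
  have hinj := Finite.injective_iff_surjective.mpr hsurj
  have h01 : (0 : K) = -1 := hinj (by simp)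
  exact one_ne_zero (α := K) (by linear_combination h01)

/-- The form `Σ xᵢ yᵢ` in `2r` variables, whose quadric is `Q⁺(2r-1,q)`. -/
noncomputable def hyperbolicForm (K : Type*) [Field K] (r : ℕ) :
    QuadraticForm K (Module.Dual K (Fin r → K) × (Fin r → K)) :=
  QuadraticForm.dualProd K (Fin r → K)

/-- The form `Σ xᵢ yᵢ + z²` in `2r+1` variables, whose quadric is `Q(2r,q)`. -/
noncomputable def parabolicForm (K : Type*) [Field K] (r : ℕ) :
    QuadraticForm K ((Module.Dual K (Fin r → K) × (Fin r → K)) × K) :=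
  (hyperbolicForm K r).prod QuadraticMap.sq

/-- An anisotropic binary form `x² + xy + dy²`. -/
noncomputable def anisotropicBinaryForm (K : Type*) [Field K] [Finite K] :
    QuadraticForm K (K × K) :=
  QuadraticMap.linMulLin (LinearMap.fst K K K) (LinearMap.fst K K K)
    + QuadraticMap.linMulLin (LinearMap.fst K K K) (LinearMap.snd K K K)
    + (exists_anisotropic_coeff K).choose •
      QuadraticMap.linMulLin (LinearMap.snd K K K) (LinearMap.snd K K K)

/-- The form `Σ xᵢ yᵢ + f(z,w)` in `2r+2` variables with `f` anisotropic, whose quadric is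
`Q⁻(2r+1,q)`. -/
noncomputable def ellipticForm (K : Type*) [Field K] [Finite K] (r : ℕ) :
    QuadraticForm K ((Module.Dual K (Fin r → K) × (Fin r → K)) × (K × K)) :=
  (hyperbolicForm K r).prod (anisotropicBinaryForm K)

/-- The same form with one more variable that does not occur in the equation: its quadric is the
cone `PC` with vertex a point over the quadric `C` of `Q`. -/
noncomputable def coneForm {K V : Type*} [Field K] [AddCommGroup V] [Module K V]
    (Q : QuadraticForm K V) : QuadraticForm K (V × K) :=
  Q.prod (0 : QuadraticForm K K)

/-- `S` is a parabolic quasi-quadric in `PG(2n,q)` (for `n ≥ 1`): every hyperplane meets `S` in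
`|Q⁻(2n-1,q)|`, `|PQ(2n-2,q)|` or `|Q⁺(2n-1,q)|` points. -/
def IsParabolicQuasiQuadric {K V : Type*} [Field K] [Finite K] [AddCommGroup V] [Module K V]
    (n : ℕ) (S : Set (ℙ K V)) : Prop :=
  ∀ H : Submodule K V, IsHyperplaneOf H ⊤ →
    (S ∩ pts H).ncard = (quadric (ellipticForm K (n - 1))).ncard ∨
    (S ∩ pts H).ncard = (quadric (coneForm (parabolicForm K (n - 1)))).ncard ∨
    (S ∩ pts H).ncard = (quadric (hyperbolicForm K n)).ncard

/-- `N` is a nucleus of `S`: it is not in `S`, and every line through `N` has exactly one point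
in `S`. -/
def IsNucleus {K V : Type*} [Field K] [AddCommGroup V] [Module K V]
    (S : Set (ℙ K V)) (N : ℙ K V) : Prop :=
  N ∉ S ∧ ∀ l : Submodule K V, Module.finrank K l = 2 → N ∈ pts l → (S ∩ pts l).ncard = 1

/-- The point set of the cone with vertex the point `P` and base `C`. -/
def cone {K V : Type*} [Field K] [AddCommGroup V] [Module K V]
    (P : ℙ K V) (C : Set (ℙ K V)) : Set (ℙ K V) :=
  {P} ∪ ⋃ Y ∈ C, pts (lineThrough P Y)

/-- `π` is a singular hyperplane with vertex `P` of the quadric of `Q`: it meets the quadric in a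
cone with vertex `P` and base a nonsingular quadric in a hyperplane `μ` of `π` not through `P`. -/
def IsSingularHyperplane {K V : Type*} [Field K] [AddCommGroup V] [Module K V]
    (Q : QuadraticForm K V) (π : Submodule K V) (P : ℙ K V) : Prop :=
  IsHyperplaneOf π ⊤ ∧ P ∈ pts π ∧
    ∃ μ : Submodule K V, IsHyperplaneOf μ π ∧ P ∉ pts μ ∧
      IsNonsingularForm (Q.comp μ.subtype) ∧
      quadric Q ∩ pts π = cone P (quadric Q ∩ pts μ)

/-- `S'` is obtained by switching `S` in the hyperplane `π`: a set `R` of points of `π` is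
replaced with a set `R'` of points of `π`. -/
def IsSwitching {K V : Type*} [Field K] [AddCommGroup V] [Module K V]
    (S S' : Set (ℙ K V)) (π : Submodule K V) : Prop :=
  ∃ R R' : Set (ℙ K V), R ⊆ pts π ∧ R' ⊆ pts π ∧ S' = (S \ R) ∪ R'

/-- `t` is a truncated line through `C`: the points of a line through `C`, except `C`. -/
def IsTruncatedLine {K V : Type*} [Field K] [AddCommGroup V] [Module K V]
    (C : ℙ K V) (t : Set (ℙ K V)) : Prop :=
  ∃ l : Submodule K V, Module.finrank K l = 2 ∧ C ∈ pts l ∧ t = pts l \ {C}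

/-- `L` is a set of truncated lines of `π`, each through `P` or through `N`, such that the only
points lying on more than one of them are possibly `P` and `N`. -/
def IsTruncatedLineSet {K V : Type*} [Field K] [AddCommGroup V] [Module K V]
    (P N : ℙ K V) (π : Submodule K V) (L : Set (Set (ℙ K V))) : Prop :=
  (∀ t ∈ L, t ⊆ pts π ∧ (IsTruncatedLine P t ∨ IsTruncatedLine N t)) ∧
    ∀ s ∈ L, ∀ t ∈ L, s ≠ t → s ∩ t ⊆ {P, N}

/-- Every hyperplane of `π` through `P` or `N` meets `S` in `|PQ⁻(2n-3,q)|`, `|Q(2n-2,q)|` or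
`|PQ⁺(2n-3,q)|` points (for `n ≥ 2`). -/
def HasConelikeSections {K V : Type*} [Field K] [Finite K] [AddCommGroup V] [Module K V]
    (n : ℕ) (P N : ℙ K V) (π : Submodule K V) (S : Set (ℙ K V)) : Prop :=
  ∀ ν : Submodule K V, IsHyperplaneOf ν π → P ∈ pts ν ∨ N ∈ pts ν →
    (S ∩ pts ν).ncard = (quadric (coneForm (ellipticForm K (n - 2)))).ncard ∨
    (S ∩ pts ν).ncard = (quadric (parabolicForm K (n - 1))).ncard ∨
    (S ∩ pts ν).ncard = (quadric (coneForm (hyperbolicForm K (n - 1)))).ncard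

/-! Counting vectors instead of points turns every size into q^d + ε(q-1)q^k with ε in {-1, 0, 1}.
Let p, n represent P, N and let dim V = 2r+3. The nucleus lies in the radical of the polar form, and
π is the tangent hyperplane p^⊥, which contains n. Outside π, a hyperplane H ≠ π contains
(q-1)q^(2r) zeros of Q if p or n lies in H; otherwise ε(q-1)q^r is added, with ε = ±1 depending on
H.

Direct part. Let ν be a hyperplane of π missing P and N. Both signs occur among the hyperplanes H ≠
π through ν (`exists_section_of_sign`), and only a trace of exactly q^(2r) vectors on ν is
compatible with both. Hence the Fourier transform of the indicator function of the trace T on π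
vanishes at each functional that is nonzero at both p and n. The remaining characters are each
invariant under p or under n, so mixed second differences of the indicator vanish
(`indicator_second_difference`). A 0/1-valued function of the form a(s) + b(t) depends on one
variable only (`IsGridAdditive.isRuled_or`), so off PN the set T splits into truncated lines through
P or N. The same identity based at the zero vector settles the line PN. If ν contains P or N, the
part of H outside π has constant size, and ε passes to the trace.

Converse. The count runs backwards once the size of the new trace and its sections missing P and N
are known. Reducing the assumed section sizes modulo q determines how the line PN enters, and then
each truncated line counts once in such a section (`IsTruncatedLineSet.ncard_sections`). -/

/-! ### From projective points to vectors. -/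

section VectorCone

variable {K V : Type*} [Field K] [AddCommGroup V] [Module K V]

/-- The vectors representing points of `S`, together with `0`. -/
def vectorCone (S : Set (ℙ K V)) : Set V :=
  {v | ∀ h : v ≠ 0, Projectivization.mk K v h ∈ S}

theorem zero_mem_vectorCone (S : Set (ℙ K V)) : (0 : V) ∈ vectorCone S :=
  fun h => absurd rfl h

theorem mem_vectorCone_iff {S : Set (ℙ K V)} {v : V} (hv : v ≠ 0) :
    v ∈ vectorCone S ↔ Projectivization.mk K v hv ∈ S :=
  ⟨fun h => h hv, fun h _ => h⟩

theorem mk_smul_eq (c : K) (v : V) (hv : v ≠ 0) (hcv : c • v ≠ 0) :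
    Projectivization.mk K (c • v) hcv = Projectivization.mk K v hv :=
  (Projectivization.mk_eq_mk_iff' K _ _ _ _).2 ⟨c, rfl⟩

theorem smul_mem_vectorCone_iff (S : Set (ℙ K V)) {c : K} (hc : c ≠ 0) (v : V) :
    c • v ∈ vectorCone S ↔ v ∈ vectorCone S := by
  by_cases hv : v = 0
  · simp [hv]
  · have hcv : c • v ≠ 0 := smul_ne_zero hc hv
    rw [mem_vectorCone_iff hv, mem_vectorCone_iff hcv, mk_smul_eq c v hv hcv]

theorem rep_mem_vectorCone_iff (S : Set (ℙ K V)) (X : ℙ K V) :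
    X.rep ∈ vectorCone S ↔ X ∈ S := by
  rw [mem_vectorCone_iff X.rep_nonzero, Projectivization.mk_rep]

theorem mk_mem_pts (W : Submodule K V) (v : V) (hv : v ≠ 0) :
    Projectivization.mk K v hv ∈ pts W ↔ v ∈ W := by
  simp [pts, Projectivization.submodule_mk]

theorem mem_pts_iff_rep (W : Submodule K V) (X : ℙ K V) : X ∈ pts W ↔ X.rep ∈ W := by
  rw [← mk_mem_pts W X.rep X.rep_nonzero, Projectivization.mk_rep]

theorem vectorCone_inter (S T : Set (ℙ K V)) :
    vectorCone (S ∩ T) = vectorCone S ∩ vectorCone T := by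
  ext v
  exact ⟨fun h => ⟨fun hv => (h hv).1, fun hv => (h hv).2⟩, fun h hv => ⟨h.1 hv, h.2 hv⟩⟩

theorem vectorCone_pts (W : Submodule K V) : vectorCone (pts W) = (W : Set V) := by
  ext v
  by_cases hv : v = 0
  · simp [hv, zero_mem_vectorCone]
  · rw [mem_vectorCone_iff hv, mk_mem_pts, SetLike.mem_coe]

theorem vectorCone_quadric (Q : QuadraticForm K V) : vectorCone (quadric Q) = {v | Q v = 0} := by
  ext v
  by_cases hv : v = 0
  · simp [hv, zero_mem_vectorCone]
  · rw [mem_vectorCone_iff hv, mk_mem_quadric, Set.mem_ofPred_eq]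

/-- Each point has exactly q-1 nonzero representatives, and the zero vector accounts for the extra
1. -/
theorem card_sub_one_mul_ncard_add_one [Finite K] [Finite V] (S : Set (ℙ K V)) :
    (Nat.card K - 1) * S.ncard + 1 = (vectorCone S).ncard := by
  have hins : vectorCone S = insert 0 {v | v ≠ 0 ∧ v ∈ vectorCone S} := by
    ext v
    by_cases hv : v = 0 <;> simp [hv, zero_mem_vectorCone]
  rw [hins, Set.ncard_insert_of_notMem (by simp) (Set.toFinite _)]
  congr 1
  have hK : Nat.card Kˣ = Nat.card K - 1 := Nat.card_units K
  rw [← hK, mul_comm, ← Nat.card_coe_set_eq, ← Nat.card_coe_set_eq, ← Nat.card_prod]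
  let f : S × Kˣ → {v | v ≠ 0 ∧ v ∈ vectorCone S} := fun x =>
    ⟨(x.2 : K) • x.1.1.rep, smul_ne_zero x.2.ne_zero x.1.1.rep_nonzero, by
      rw [smul_mem_vectorCone_iff S x.2.ne_zero, rep_mem_vectorCone_iff]; exact x.1.2⟩
  refine Nat.card_congr (Equiv.ofBijective f ⟨?_, ?_⟩)
  · rintro ⟨⟨X, hX⟩, c⟩ ⟨⟨Y, hY⟩, d⟩ h
    have h' : (c : K) • X.rep = (d : K) • Y.rep := congrArg Subtype.val h
    have hXY : X = Y := by
      rw [← X.mk_rep, ← Y.mk_rep, ← mk_smul_eq (c : K) X.rep X.rep_nonzero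
        (smul_ne_zero c.ne_zero X.rep_nonzero), ← mk_smul_eq (d : K) Y.rep Y.rep_nonzero
        (smul_ne_zero d.ne_zero Y.rep_nonzero)]
      congr 1
    subst hXY
    have hcd : (c : K) = d := smul_left_injective K X.rep_nonzero h'
    simp [Units.ext hcd]
  · rintro ⟨v, hv, hvS⟩
    obtain ⟨a, ha⟩ := Projectivization.exists_smul_eq_mk_rep K v hv
    refine ⟨⟨⟨Projectivization.mk K v hv, hvS hv⟩, a⁻¹⟩, Subtype.ext ?_⟩
    change ((a⁻¹ : Kˣ) : K) • (Projectivization.mk K v hv).rep = v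
    rw [← ha, ← Units.smul_def, inv_smul_smul]

theorem int_ncard_vectorCone [Finite K] [Finite V] (S : Set (ℙ K V)) :
    ((vectorCone S).ncard : ℤ) = ((Nat.card K : ℤ) - 1) * S.ncard + 1 := by
  rw [← card_sub_one_mul_ncard_add_one]
  have : 1 ≤ Nat.card K := Nat.card_pos
  push_cast [this]
  rfl

/-- Fibring a set of vectors by the lines in the direction `u`. -/
theorem card_mul_ncard_of_translate [Finite K] [Finite V] (u : V) (A B : Set V)
    (hAB : ∀ a ∈ A, ∀ t : K, a + t • u ∈ B) (hB : ∀ b ∈ B, ∃! t : K, b - t • u ∈ A) :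
    Nat.card K * A.ncard = B.ncard := by
  rw [mul_comm, ← Nat.card_coe_set_eq, ← Nat.card_coe_set_eq, ← Nat.card_prod]
  let f : A × K → B := fun x => ⟨x.1.1 + x.2 • u, hAB _ x.1.2 _⟩
  refine Nat.card_congr (Equiv.ofBijective f ⟨?_, ?_⟩)
  · rintro ⟨⟨a, ha⟩, s⟩ ⟨⟨b, hb⟩, t⟩ h
    have h' : a + s • u = b + t • u := congrArg Subtype.val h
    have hst : s = t := (hB _ (hAB a ha s)).unique (by simpa using ha) (by rw [h']; simpa using hb)
    subst hst
    simpa using h'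
  · rintro ⟨b, hb⟩
    obtain ⟨t, ht, -⟩ := hB b hb
    exact ⟨⟨⟨_, ht⟩, t⟩, Subtype.ext (by simp [f])⟩

end VectorCone

/-! ### Exponential sums of quadratic forms in characteristic two. -/

section CharacterSum

variable {K : Type*} [Field K]

theorem exists_addChar_ne_one (K : Type*) [Field K] [Finite K] : ∃ χ : AddChar K ℂ, χ ≠ 1 := by
  obtain ⟨χ, hχ⟩ := (AddChar.exists_apply_ne_zero (a := (1 : K))).2 one_ne_zero
  exact ⟨χ, fun h => hχ (by simp [h])⟩

theorem sum_addChar_eq_zero {G : Type*} [Fintype G] [AddCommGroup G] {χ : AddChar G ℂ}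
    (hχ : χ ≠ 1) : ∑ g, χ g = 0 :=
  AddChar.sum_eq_zero_iff_ne_zero.2 hχ

theorem sum_addChar_linear {W : Type*} [Fintype W] [AddCommGroup W] [Module K W]
    {χ : AddChar K ℂ} (hχ : χ ≠ 1) (f : W →ₗ[K] K) (hf : f ≠ 0) :
    ∑ w : W, χ (f w) = 0 := by
  refine sum_addChar_eq_zero (χ := χ.compAddMonoidHom f.toAddMonoidHom) fun h1 => hχ ?_
  ext a
  obtain ⟨w, hw⟩ := LinearMap.surjective hf a
  have := DFunLike.congr_fun h1 w
  simpa [hw] using this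

theorem sum_addChar_mul [Fintype K] {χ : AddChar K ℂ} (hχ : χ ≠ 1) (a : K) [Decidable (a = 0)] :
    ∑ c : K, χ (c * a) = if a = 0 then (Nat.card K : ℂ) else 0 := by
  split_ifs with h
  · simp [h]
  · exact sum_addChar_linear hχ (LinearMap.mulRight K a)
      fun h0 => h (by simpa using LinearMap.congr_fun h0 1)

theorem sum_dual_addChar {W : Type*} [AddCommGroup W] [Module K W] [Finite W] [Finite K]
    [Fintype (Module.Dual K W)] {χ : AddChar K ℂ} (hχ : χ ≠ 1) (w : W) [Decidable (w = 0)] :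
    ∑ f : Module.Dual K W, χ (f w) = if w = 0 then (Nat.card W : ℂ) else 0 := by
  have : FiniteDimensional K W := Module.Finite.of_finite
  split_ifs with h
  · have : Nat.card (Module.Dual K W) = Nat.card W := by
      rw [Module.natCard_eq_pow_finrank (K := K), Subspace.dual_finrank_eq,
        ← Module.natCard_eq_pow_finrank]
    simp [h, ← this]
  · exact sum_addChar_linear hχ (Module.Dual.eval K W w)
      fun h0 => h ((Module.forall_dual_apply_eq_zero_iff K w).1 fun f => LinearMap.congr_fun h0 f)

/-- The exponential sum of a `K`-valued function with respect to the additive character `χ`. -/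
noncomputable def charSum {W : Type*} [Finite W] (χ : AddChar K ℂ) (F : W → K) : ℂ :=
  letI := Fintype.ofFinite W
  ∑ w, χ (F w)

theorem charSum_eq_sum {W : Type*} [Fintype W] (χ : AddChar K ℂ) (F : W → K) :
    charSum χ F = ∑ w, χ (F w) := by
  unfold charSum
  congr!

theorem charSum_prod {U W : Type*} [Finite U] [Finite W] (χ : AddChar K ℂ) (F : U → K)
    (G : W → K) : charSum χ (fun x : U × W => F x.1 + G x.2) = charSum χ F * charSum χ G := by
  have := Fintype.ofFinite U
  have := Fintype.ofFinite W
  simp [charSum_eq_sum, Fintype.sum_prod_type, AddChar.map_add_eq_mul, Finset.sum_mul_sum]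

theorem exists_sq_eq_of_charP_two [Finite K] [CharP K 2] (a : K) : ∃ b : K, b ^ 2 = a := by
  obtain ⟨b, rfl⟩ := FiniteField.isSquare_of_char_two (ringChar.eq K 2) a
  exact ⟨b, sq b⟩

theorem sq_injective_of_charP_two [CharP K 2] {a b : K} (h : a ^ 2 = b ^ 2) : a = b := by
  have h2 : (a - b) ^ 2 = 0 := by
    linear_combination h + (b ^ 2 - a * b) * (CharTwo.two_eq_zero : (2 : K) = 0)
  exact sub_eq_zero.1 (pow_eq_zero_iff two_ne_zero |>.1 h2)

/-- The number of zeros of a quadratic form in characteristic two, by an exponential sum. -/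
theorem card_mul_ncard_zeros [Finite K] [CharP K 2] {W : Type*} [Finite W] [AddCommGroup W]
    [Module K W] {χ : AddChar K ℂ} (hχ : χ ≠ 1) (Q : QuadraticForm K W) :
    (Nat.card K : ℂ) * ({v | Q v = 0} : Set W).ncard =
      Nat.card W + (Nat.card K - 1) * charSum χ Q := by
  classical
  have := Fintype.ofFinite W
  have := Fintype.ofFinite K
  have h1 : ∑ v : W, ∑ c : K, χ (c * Q v) =
      (Nat.card K : ℂ) * ({v | Q v = 0} : Set W).ncard := by
    simp_rw [sum_addChar_mul hχ]
    rw [← Finset.sum_filter, Finset.sum_const, nsmul_eq_mul, mul_comm,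
      Set.ncard_eq_toFinset_card']
    simp
  -- Every scalar is a square b², and the substitution v ↦ bv absorbs it, so all nonzero c
  -- contribute equally.
  have h2 (c : K) (hc : c ≠ 0) : ∑ v : W, χ (c * Q v) = charSum χ Q := by
    obtain ⟨b, rfl⟩ := exists_sq_eq_of_charP_two c
    have hb : b ≠ 0 := fun h => hc (by simp [h])
    rw [charSum_eq_sum]
    refine Fintype.sum_equiv (LinearEquiv.smulOfNeZero K W b hb).toEquiv _ _ fun v => ?_
    simp [QuadraticMap.map_smul, sq]
  rw [← h1, Finset.sum_comm, ← Finset.add_sum_erase _ _ (Finset.mem_univ 0),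
    Finset.sum_congr rfl fun c hc => h2 c (Finset.ne_of_mem_erase hc)]
  simp [Finset.card_erase_of_mem, Nat.cast_sub, Nat.one_le_iff_ne_zero]

/-- Write the square as a double sum and put y = x + u. In characteristic two, Q(x) + Q(x+u) = Q(u)
+ B(u,x) with B the polar form, and by nondegeneracy the sum over x vanishes unless u = 0. Hence the
exponential sum is determined up to sign, which is the elliptic/hyperbolic alternative. -/
theorem charSum_sq_of_nondegenerate [CharP K 2] {W : Type*} [Finite W] [AddCommGroup W]
    [Module K W] {χ : AddChar K ℂ} (hχ : χ ≠ 1) (Q : QuadraticForm K W)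
    (hQ : ∀ v, (∀ w, QuadraticMap.polar Q v w = 0) → v = 0) :
    charSum χ Q ^ 2 = Nat.card W := by
  have := Fintype.ofFinite W
  have h0 (u : W) (hu : u ≠ 0) : ∑ x : W, χ (QuadraticMap.polar Q u x) = 0 :=
    sum_addChar_linear hχ (QuadraticMap.polarBilin Q u)
      fun h => hu (hQ u fun w => LinearMap.congr_fun h w)
  have hadd (x u : W) : Q x + Q (x + u) = Q u + QuadraticMap.polar Q u x := by
    have h2 : (2 : K) = 0 := CharTwo.two_eq_zero
    rw [QuadraticMap.polar, add_comm u x]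
    linear_combination (Q x) * h2
  rw [charSum_eq_sum, sq, Finset.sum_mul_sum]
  calc ∑ x, ∑ y, χ (Q x) * χ (Q y)
      = ∑ x, ∑ u, χ (Q u) * χ (QuadraticMap.polar Q u x) := by
        refine Finset.sum_congr rfl fun x _ => ?_
        symm
        refine Fintype.sum_equiv (Equiv.addLeft x) _ _ fun u => ?_
        rw [← AddChar.map_add_eq_mul, ← hadd, AddChar.map_add_eq_mul]
        rfl
    _ = ∑ u, χ (Q u) * ∑ x, χ (QuadraticMap.polar Q u x) := by
        rw [Finset.sum_comm]
        simp_rw [Finset.mul_sum]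
    _ = Nat.card W := by
        rw [Finset.sum_eq_single 0 (fun u _ hu => by rw [h0 u hu, mul_zero]) (by simp)]
        simp [QuadraticMap.polar]

instance finite_dual {W : Type*} [AddCommGroup W] [Module K W] [Finite K] [Finite W] :
    Finite (Module.Dual K W) :=
  have : FiniteDimensional K W := Module.Finite.of_finite
  Module.finite_of_finite K

/-- The form is linear in the dual variable; summing over that variable first leaves only the term x
= 0. -/
theorem charSum_hyperbolicForm [Finite K] {χ : AddChar K ℂ} (hχ : χ ≠ 1) (r : ℕ) :
    charSum χ (hyperbolicForm K r) = (Nat.card K : ℂ) ^ r := by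
  classical
  have := Fintype.ofFinite K
  have := Fintype.ofFinite (Module.Dual K (Fin r → K))
  rw [charSum_eq_sum, Fintype.sum_prod_type_right]
  have (x : Fin r → K) : ∑ f : Module.Dual K (Fin r → K), χ (hyperbolicForm K r (f, x)) =
      if x = 0 then (Nat.card (Fin r → K) : ℂ) else 0 := sum_dual_addChar hχ x
  simp [this]

theorem charSum_coneForm {W : Type*} [AddCommGroup W] [Module K W] [Finite K] [Finite W]
    (χ : AddChar K ℂ) (Q : QuadraticForm K W) :
    charSum χ (coneForm Q) = Nat.card K * charSum χ Q := by
  have := Fintype.ofFinite K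
  rw [mul_comm, show (Nat.card K : ℂ) = charSum χ (0 : QuadraticForm K K) by
    simp [charSum_eq_sum]]
  exact charSum_prod χ Q (0 : QuadraticForm K K)

/-- Squaring permutes K, so the factor belonging to z² is the full sum of a nontrivial character. -/
theorem charSum_parabolicForm [Finite K] [CharP K 2] {χ : AddChar K ℂ} (hχ : χ ≠ 1) (r : ℕ) :
    charSum χ (parabolicForm K r) = 0 := by
  have := Fintype.ofFinite K
  have h0 : charSum χ (QuadraticMap.sq (R := K)) = 0 := by
    rw [charSum_eq_sum, ← sum_addChar_eq_zero hχ]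
    refine Fintype.sum_bijective (fun x : K => x ^ 2)
      (Finite.injective_iff_bijective.1 fun _ _ => sq_injective_of_charP_two) _ _ fun x => ?_
    simp [sq]
  exact (charSum_prod χ (hyperbolicForm K r) (QuadraticMap.sq (R := K))).trans
    (by rw [h0, mul_zero])

/-- The only zero is the origin, so `card_mul_ncard_zeros` can be solved for the exponential sum. -/
theorem charSum_anisotropicBinaryForm [Finite K] [CharP K 2] {χ : AddChar K ℂ} (hχ : χ ≠ 1) :
    charSum χ (anisotropicBinaryForm K) = -Nat.card K := by
  have hd := (exists_anisotropic_coeff K).choose_spec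
  have hval (x y : K) : anisotropicBinaryForm K (x, y) =
      x * x + x * y + (exists_anisotropic_coeff K).choose * (y * y) := rfl
  generalize (exists_anisotropic_coeff K).choose = d at hd hval
  have hz : ({v | anisotropicBinaryForm K v = 0} : Set (K × K)) = {0} := by
    ext ⟨x, y⟩
    simp only [Set.mem_ofPred_eq, Set.mem_singleton_iff, Prod.mk_eq_zero, hval]
    constructor
    · intro h
      have hy : y = 0 := by
        by_contra hy
        apply hd (x / y)
        field_simp
        linear_combination h
      subst hy
      simpa using h
    · rintro ⟨rfl, rfl⟩
      simp
  have h := card_mul_ncard_zeros hχ (anisotropicBinaryForm K)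
  rw [hz, Set.ncard_singleton, Nat.card_prod] at h
  have hq : (Nat.card K : ℂ) - 1 ≠ 0 := by
    rw [sub_ne_zero]
    exact_mod_cast (Finite.one_lt_card (α := K)).ne'
  apply mul_left_cancel₀ hq
  push_cast at h
  linear_combination -h

theorem charSum_ellipticForm [Finite K] [CharP K 2] {χ : AddChar K ℂ} (hχ : χ ≠ 1) (r : ℕ) :
    charSum χ (ellipticForm K r) = -(Nat.card K : ℂ) ^ (r + 1) := by
  refine (charSum_prod χ (hyperbolicForm K r) (anisotropicBinaryForm K)).trans ?_
  rw [charSum_anisotropicBinaryForm hχ, charSum_hyperbolicForm hχ]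
  ring

end CharacterSum

/-! ### Sizes of the model quadrics and cones. -/

section ModelCounts

theorem natCard_hyperbolic_space (K : Type*) [Field K] (r : ℕ) :
    Nat.card (Module.Dual K (Fin r → K) × (Fin r → K)) = Nat.card K ^ (2 * r) := by
  rw [Nat.card_prod, Module.natCard_eq_pow_finrank (K := K) (V := Module.Dual K (Fin r → K)),
    Subspace.dual_finrank_eq, Module.finrank_fin_fun, Nat.card_fun, Nat.card_fin]
  ring

variable (K : Type*) [Field K] [Finite K] [CharP K 2]

/-- The number of vectors representing points of a quadric, from the exponential sum. -/
theorem ncard_vectorCone_quadric_of_charSum {W : Type*} [Finite W] [AddCommGroup W]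
    [Module K W] {χ : AddChar K ℂ} (hχ : χ ≠ 1) (Q : QuadraticForm K W) {d k : ℕ} {ε : ℤ}
    (hW : Nat.card W = Nat.card K ^ (d + 1))
    (hQ : charSum χ Q = ε * (Nat.card K : ℂ) ^ (k + 1)) :
    ((vectorCone (quadric Q)).ncard : ℤ) =
      (Nat.card K : ℤ) ^ d + ε * (((Nat.card K : ℤ) - 1) * (Nat.card K : ℤ) ^ k) := by
  have h := card_mul_ncard_zeros hχ Q
  rw [hW, hQ] at h
  rw [vectorCone_quadric]
  have hq : (Nat.card K : ℤ) ≠ 0 := by exact_mod_cast (Nat.card_pos (α := K)).ne'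
  apply mul_left_cancel₀ hq
  have h' : ((Nat.card K : ℤ) * (({v | Q v = 0} : Set W).ncard : ℤ) : ℤ) =
      (Nat.card K : ℤ) ^ (d + 1) +
        ((Nat.card K : ℤ) - 1) * (ε * (Nat.card K : ℤ) ^ (k + 1)) := by
    exact_mod_cast h
  rw [h']
  ring

/-- The factor 1, like the -1 in the elliptic case, keeps the common shape q^d + ε(q-1)q^k, over
whose ε the intersection conditions are later quantified. -/
theorem ncard_quadric_hyperbolicForm (r : ℕ) :
    ((Nat.card K : ℤ) - 1) * (quadric (hyperbolicForm K (r + 1))).ncard + 1 =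
      (Nat.card K : ℤ) ^ (2 * r + 1) + 1 * (((Nat.card K : ℤ) - 1) * (Nat.card K : ℤ) ^ r) := by
  obtain ⟨χ, hχ⟩ := exists_addChar_ne_one K
  rw [← int_ncard_vectorCone]
  apply ncard_vectorCone_quadric_of_charSum K hχ
  · rw [natCard_hyperbolic_space]; ring
  · rw [charSum_hyperbolicForm hχ]; simp

theorem ncard_quadric_ellipticForm (r : ℕ) :
    ((Nat.card K : ℤ) - 1) * (quadric (ellipticForm K r)).ncard + 1 =
      (Nat.card K : ℤ) ^ (2 * r + 1) + (-1) * (((Nat.card K : ℤ) - 1) * (Nat.card K : ℤ) ^ r) := by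
  obtain ⟨χ, hχ⟩ := exists_addChar_ne_one K
  rw [← int_ncard_vectorCone]
  apply ncard_vectorCone_quadric_of_charSum K hχ
  · rw [Nat.card_prod, natCard_hyperbolic_space, Nat.card_prod]; ring
  · rw [charSum_ellipticForm hχ]; simp

theorem ncard_quadric_parabolicForm (r : ℕ) :
    ((Nat.card K : ℤ) - 1) * (quadric (parabolicForm K r)).ncard + 1 =
      (Nat.card K : ℤ) ^ (2 * r) := by
  obtain ⟨χ, hχ⟩ := exists_addChar_ne_one K
  rw [← int_ncard_vectorCone, ncard_vectorCone_quadric_of_charSum K hχ (d := 2 * r) (k := 0)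
    (ε := 0)]
  · simp
  · rw [Nat.card_prod, natCard_hyperbolic_space]; ring
  · rw [charSum_parabolicForm hχ]; simp

theorem ncard_quadric_coneForm_parabolicForm (r : ℕ) :
    ((Nat.card K : ℤ) - 1) * (quadric (coneForm (parabolicForm K r))).ncard + 1 =
      (Nat.card K : ℤ) ^ (2 * r + 1) := by
  obtain ⟨χ, hχ⟩ := exists_addChar_ne_one K
  rw [← int_ncard_vectorCone, ncard_vectorCone_quadric_of_charSum K hχ (d := 2 * r + 1) (k := 0)
    (ε := 0)]
  · simp
  · rw [Nat.card_prod, Nat.card_prod, natCard_hyperbolic_space]; ring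
  · rw [charSum_coneForm, charSum_parabolicForm hχ]; simp

theorem ncard_quadric_coneForm_hyperbolicForm (r : ℕ) :
    ((Nat.card K : ℤ) - 1) * (quadric (coneForm (hyperbolicForm K r))).ncard + 1 =
      (Nat.card K : ℤ) ^ (2 * r) + 1 * (((Nat.card K : ℤ) - 1) * (Nat.card K : ℤ) ^ r) := by
  obtain ⟨χ, hχ⟩ := exists_addChar_ne_one K
  rw [← int_ncard_vectorCone]
  apply ncard_vectorCone_quadric_of_charSum K hχ
  · rw [Nat.card_prod, natCard_hyperbolic_space]; ring
  · rw [charSum_coneForm, charSum_hyperbolicForm hχ]; push_cast; ring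

theorem ncard_quadric_coneForm_ellipticForm (r : ℕ) :
    ((Nat.card K : ℤ) - 1) * (quadric (coneForm (ellipticForm K r))).ncard + 1 =
      (Nat.card K : ℤ) ^ (2 * r + 2) +
        (-1) * (((Nat.card K : ℤ) - 1) * (Nat.card K : ℤ) ^ (r + 1)) := by
  obtain ⟨χ, hχ⟩ := exists_addChar_ne_one K
  rw [← int_ncard_vectorCone]
  apply ncard_vectorCone_quadric_of_charSum K hχ
  · rw [Nat.card_prod, Nat.card_prod, natCard_hyperbolic_space, Nat.card_prod]; ring
  · rw [charSum_coneForm, charSum_ellipticForm hχ]; push_cast; ring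

end ModelCounts

/-! ### Hyperplanes and expansion of quadratic forms. -/

section Hyperplane

variable {K V : Type*} [Field K] [AddCommGroup V] [Module K V]

theorem IsHyperplaneOf.exists_sub_smul_mem [FiniteDimensional K V] {ν W : Submodule K V}
    (h : IsHyperplaneOf ν W) {u : V} (hu : u ∈ W) (huν : u ∉ ν) {v : V} (hv : v ∈ W) :
    ∃! c : K, v - c • u ∈ ν := by
  have hsup : ν ⊔ K ∙ u = W := by
    refine Submodule.eq_of_le_of_finrank_le (sup_le h.1 (by simpa using hu)) ?_
    rw [← h.2, Nat.succ_le_iff]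
    refine Submodule.finrank_lt_finrank_of_lt (lt_of_le_of_ne le_sup_left fun he => huν ?_)
    rw [he]
    exact Submodule.mem_sup_right (Submodule.mem_span_singleton_self u)
  rw [← hsup] at hv
  obtain ⟨m, hm, w, hw, rfl⟩ := Submodule.mem_sup.1 hv
  obtain ⟨c, rfl⟩ := Submodule.mem_span_singleton.1 hw
  refine ⟨c, by simpa using hm, fun d hd => ?_⟩
  by_contra hne
  apply huν
  have h1 : (c - d) • u ∈ ν := by
    have := ν.sub_mem hd hm
    convert this using 1
    module
  exact (ν.smul_mem_iff (sub_ne_zero.2 (Ne.symm hne))).1 h1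

theorem IsHyperplaneOf.ne {ν W : Submodule K V} (h : IsHyperplaneOf ν W) : ν ≠ W := by
  rintro rfl
  exact absurd h.2 (Nat.succ_ne_self _)

theorem isHyperplaneOf_ker [FiniteDimensional K V] {f : Module.Dual K V} (hf : f ≠ 0) :
    IsHyperplaneOf f.ker ⊤ :=
  ⟨le_top, by rw [finrank_top]; exact Module.Dual.finrank_ker_add_one_of_ne_zero hf⟩

theorem IsHyperplaneOf.inf [FiniteDimensional K V] {H π : Submodule K V}
    (hH : IsHyperplaneOf H ⊤) (hπ : IsHyperplaneOf π ⊤) (hne : H ≠ π) :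
    IsHyperplaneOf (H ⊓ π) π := by
  refine ⟨inf_le_right, ?_⟩
  have h1 := Submodule.finrank_sup_add_finrank_inf_eq H π
  have h2 : Module.finrank K H < Module.finrank K ↥(H ⊔ π) := by
    refine Submodule.finrank_lt_finrank_of_lt (lt_of_le_of_ne le_sup_left fun he => hne ?_)
    have : π ≤ H := he ▸ le_sup_right
    exact (Submodule.eq_of_le_of_finrank_eq this (by have := hH.2; have := hπ.2; omega)).symm
  have h3 := Submodule.finrank_le (H ⊔ π)
  have h4 := hH.2
  have h5 := hπ.2
  rw [finrank_top] at h4 h5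
  omega

theorem ncard_submodule [Finite K] [FiniteDimensional K V] (W : Submodule K V) :
    (W : Set V).ncard = Nat.card K ^ Module.finrank K W := by
  rw [← Nat.card_coe_set_eq]
  exact Module.natCard_eq_pow_finrank (V := W)

theorem mk_eq_iff_exists_smul_rep (v : V) (hv : v ≠ 0) (X : ℙ K V) :
    Projectivization.mk K v hv = X ↔ ∃ c : K, c • X.rep = v := by
  conv_lhs => rw [← X.mk_rep]
  exact Projectivization.mk_eq_mk_iff' K _ _ _ _

theorem QuadraticMap.map_add_smul (Q : QuadraticForm K V) (v u : V) (t : K) :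
    Q (v + t • u) = Q v + t * QuadraticMap.polar Q v u + t ^ 2 * Q u := by
  rw [QuadraticMap.map_add Q, QuadraticMap.map_smul, QuadraticMap.polar_smul_right, smul_eq_mul,
    smul_eq_mul]
  ring

theorem QuadraticMap.map_sub_smul (Q : QuadraticForm K V) (v u : V) (t : K) :
    Q (v - t • u) = Q v - t * QuadraticMap.polar Q v u + t ^ 2 * Q u := by
  rw [sub_eq_add_neg, ← neg_smul, QuadraticMap.map_add_smul]
  ring

theorem polar_self_eq_zero [CharP K 2] (Q : QuadraticForm K V) (v : V) :
    QuadraticMap.polar Q v v = 0 := by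
  rw [QuadraticMap.polar_self, two_smul, CharTwo.add_self_eq_zero]

end Hyperplane

/-! ### The nucleus and the tangent hyperplane in terms of the polar form. -/

section Tangent

variable {K V : Type*} [Field K] [AddCommGroup V] [Module K V]

theorem IsNucleus.map_rep_ne_zero {Q : QuadraticForm K V} {N : ℙ K V}
    (hN : IsNucleus (quadric Q) N) : Q N.rep ≠ 0 := hN.1

theorem finrank_span_pair {u v : V} (hu : u ≠ 0) (hv : v ∉ K ∙ u) :
    Module.finrank K (Submodule.span K {u, v}) = 2 := by
  have h : LinearIndependent K ![u, v] := by
    rw [LinearIndependent.pair_iff' hu]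
    intro a ha
    exact hv (Submodule.mem_span_singleton.2 ⟨a, ha⟩)
  have := finrank_span_eq_card h
  rwa [Matrix.range_cons_cons_empty, Fintype.card_fin] at this

/-- The line joining N to w carries a single point X of the quadric. If X were not orthogonal to N,
the quadratic equation along X + tN would have a second root and give another point. Since N is
orthogonal to itself in characteristic two and X involves w, orthogonality passes to w. -/
theorem IsNucleus.polar_rep_eq_zero [CharP K 2] {Q : QuadraticForm K V} {N : ℙ K V}
    (hN : IsNucleus (quadric Q) N) (w : V) : QuadraticMap.polar Q N.rep w = 0 := by
  have hQn := hN.map_rep_ne_zero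
  by_cases hw : w ∈ K ∙ N.rep
  · obtain ⟨c, rfl⟩ := Submodule.mem_span_singleton.1 hw
    rw [QuadraticMap.polar_smul_right, polar_self_eq_zero, smul_zero]
  have hl := hN.2 (Submodule.span K {N.rep, w}) (finrank_span_pair N.rep_nonzero hw)
    ((mem_pts_iff_rep _ _).2 (Submodule.subset_span (by simp)))
  obtain ⟨X, hX⟩ := Set.ncard_eq_one.1 hl
  have hXm : X ∈ quadric Q ∩ pts (Submodule.span K {N.rep, w}) := hX ▸ rfl
  have hQX : Q X.rep = 0 := hXm.1
  have hXl := (mem_pts_iff_rep _ _).1 hXm.2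
  have hBX : QuadraticMap.polar Q N.rep X.rep = 0 := by
    by_contra hB
    -- The nonzero root of tB(N,X) + t²Q(N) = 0.
    set t : K := -(QuadraticMap.polar Q N.rep X.rep / Q N.rep) with ht
    have ht0 : t ≠ 0 := neg_ne_zero.2 (div_ne_zero hB hQn)
    have hind : ∀ c : K, X.rep + t • N.rep ≠ c • X.rep := by
      intro c hc
      apply hQn
      have h1 : t • N.rep = (c - 1) • X.rep := by
        rw [sub_smul, ← hc, one_smul, add_sub_cancel_left]
      have h2 : Q (t • N.rep) = 0 := by rw [h1, QuadraticMap.map_smul, hQX, smul_zero]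
      rw [QuadraticMap.map_smul, smul_eq_mul] at h2
      exact (mul_eq_zero.1 h2).resolve_left (mul_ne_zero ht0 ht0)
    have h0 : X.rep + t • N.rep ≠ 0 := by simpa using hind 0
    have hY : Projectivization.mk K _ h0 ∈ quadric Q ∩ pts (Submodule.span K {N.rep, w}) := by
      refine ⟨(mk_mem_quadric Q _ h0).2 ?_, (mk_mem_pts _ _ h0).2 ?_⟩
      · rw [QuadraticMap.map_add_smul, hQX, QuadraticMap.polar_comm, ht]
        field_simp
        ring
      · exact Submodule.add_mem _ hXl (Submodule.smul_mem _ _ (Submodule.subset_span (by simp)))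
    rw [hX, Set.mem_singleton_iff, mk_eq_iff_exists_smul_rep] at hY
    obtain ⟨c, hc⟩ := hY
    exact hind c hc.symm
  obtain ⟨a, b, hab⟩ := Submodule.mem_span_pair.1 hXl
  have hb : b ≠ 0 := by
    rintro rfl
    rw [zero_smul, add_zero] at hab
    rw [← hab, QuadraticMap.map_smul, smul_eq_mul] at hQX
    have ha : a = 0 := by simpa [hQn] using hQX
    exact X.rep_nonzero (by rw [← hab, ha, zero_smul])
  rw [← hab, QuadraticMap.polar_add_right, QuadraticMap.polar_smul_right,
    QuadraticMap.polar_smul_right, polar_self_eq_zero, smul_zero, zero_add, smul_eq_mul] at hBX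
  exact (mul_eq_zero.1 hBX).resolve_left hb

/-- `π` is the tangent hyperplane at the point of `p` to the nonsingular parabolic quadric of `Q`,
whose nucleus is the point of `n`. -/
structure IsTangentHyperplane (Q : QuadraticForm K V) (p n : V) (π : Submodule K V) : Prop where
  nonsingular : IsNonsingularForm Q
  map_nucleus : Q n ≠ 0
  polar_nucleus : ∀ w, QuadraticMap.polar Q n w = 0
  ne_zero : p ≠ 0
  map_vertex : Q p = 0
  mem_iff : ∀ v, v ∈ π ↔ QuadraticMap.polar Q p v = 0

theorem IsSingularHyperplane.map_rep {Q : QuadraticForm K V} {π : Submodule K V} {P : ℙ K V}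
    (h : IsSingularHyperplane Q π P) : Q P.rep = 0 := by
  obtain ⟨-, -, μ, -, -, -, hcone⟩ := h
  have : P ∈ quadric Q ∩ pts π := by rw [hcone]; exact Or.inl rfl
  exact this.1

/-- It suffices to treat w in the base hyperplane μ. If Q(w) = 0, the cone contains P + w, which
forces B(P,w) = 0. If Q(w) ≠ 0 and B(P,w) ≠ 0, some w + tP is a zero in π; but points of the cone
project from P to zeros in μ (or equal P), contradicting Q(w) ≠ 0. -/
theorem IsSingularHyperplane.polar_rep_eq_zero [FiniteDimensional K V] [CharP K 2]
    {Q : QuadraticForm K V} {π : Submodule K V} {P : ℙ K V}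
    (h : IsSingularHyperplane Q π P) {v : V} (hv : v ∈ π) :
    QuadraticMap.polar Q P.rep v = 0 := by
  have hQP := h.map_rep
  obtain ⟨-, hPπ, μ, hμ, hPμ, -, hcone⟩ := h
  rw [mem_pts_iff_rep] at hPπ hPμ
  have hμ0 : ∀ w ∈ μ, QuadraticMap.polar Q P.rep w = 0 := by
    intro w hw
    by_contra hB
    have hw0 : w ≠ 0 := by rintro rfl; simp at hB
    by_cases hQw : Q w = 0
    · have h0 : P.rep + w ≠ 0 := fun h0 => hPμ (by
        rw [eq_neg_of_add_eq_zero_left h0]; exact μ.neg_mem hw)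
      have hmem : Projectivization.mk K _ h0 ∈ quadric Q ∩ pts π := by
        rw [hcone]
        refine Or.inr (Set.mem_biUnion (x := Projectivization.mk K w hw0)
          ⟨(mk_mem_quadric Q w hw0).2 hQw, (mk_mem_pts μ w hw0).2 hw⟩ ?_)
        rw [mk_mem_pts, lineThrough, Projectivization.submodule_mk, Projectivization.submodule_eq]
        exact Submodule.add_mem_sup (Submodule.mem_span_singleton_self _)
          (Submodule.mem_span_singleton_self _)
      have := (mk_mem_quadric Q _ h0).1 hmem.1
      rw [QuadraticMap.map_add Q, hQP, hQw] at this
      exact hB (by simpa using this)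
    · set t : K := -(Q w / QuadraticMap.polar Q P.rep w) with ht
      have h0 : w + t • P.rep ≠ 0 := by
        intro h0
        have ht0 : t ≠ 0 := by
          rintro h1
          rw [h1, zero_smul, add_zero] at h0
          exact hw0 h0
        apply hPμ
        rw [← μ.smul_mem_iff ht0, eq_neg_of_add_eq_zero_right h0]
        exact μ.neg_mem hw
      have hmem : Projectivization.mk K _ h0 ∈ quadric Q ∩ pts π := by
        refine ⟨(mk_mem_quadric Q _ h0).2 ?_, (mk_mem_pts _ _ h0).2
          (π.add_mem (hμ.1 hw) (π.smul_mem _ hPπ))⟩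
        rw [QuadraticMap.map_add_smul, hQP, QuadraticMap.polar_comm, ht]
        field_simp
        ring
      rw [hcone] at hmem
      have hwt : ∀ y ∈ μ, Q y = 0 → ∀ a b : K, w + t • P.rep ≠ a • P.rep + b • y := by
        intro y hy hQy a b hab
        have h1 : (t - a) • P.rep = b • y - w := by
          rw [sub_smul, sub_eq_sub_iff_add_eq_add, add_comm (t • _), hab, add_comm]
        have hta : t - a = 0 := by
          by_contra hta
          apply hPμ
          rw [← μ.smul_mem_iff hta, h1]
          exact μ.sub_mem (μ.smul_mem _ hy) hw
        rw [hta, zero_smul, eq_comm, sub_eq_zero] at h1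
        apply hQw
        rw [← h1, QuadraticMap.map_smul, hQy, smul_zero]
      rcases hmem with hmem | hmem
      · rw [Set.mem_singleton_iff, mk_eq_iff_exists_smul_rep] at hmem
        obtain ⟨a, ha⟩ := hmem
        refine hwt 0 μ.zero_mem (by simp) a 0 ?_
        simpa using ha.symm
      · simp only [Set.mem_iUnion] at hmem
        obtain ⟨Y, ⟨hY1, hY2⟩, hY3⟩ := hmem
        rw [mk_mem_pts, lineThrough, Projectivization.submodule_eq P,
          Projectivization.submodule_eq Y, Submodule.mem_sup] at hY3
        obtain ⟨y, hy, z, hz, hyz⟩ := hY3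
        obtain ⟨a, rfl⟩ := Submodule.mem_span_singleton.1 hy
        obtain ⟨b, rfl⟩ := Submodule.mem_span_singleton.1 hz
        exact hwt Y.rep ((mem_pts_iff_rep _ _).1 hY2) hY1 a b hyz.symm
  obtain ⟨c, hc, -⟩ := hμ.exists_sub_smul_mem hPπ hPμ hv
  have := hμ0 _ hc
  rwa [QuadraticMap.polar_sub_right, QuadraticMap.polar_smul_right, polar_self_eq_zero,
    smul_zero, sub_zero] at this

/-- The inclusion of π in P^⊥ is an equality: P^⊥ is proper because P is a zero of a nonsingular
form, and π is already a hyperplane. -/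
theorem IsSingularHyperplane.isTangentHyperplane [FiniteDimensional K V] [CharP K 2]
    {Q : QuadraticForm K V} (hQ : IsNonsingularForm Q) {N : ℙ K V} (hN : IsNucleus (quadric Q) N)
    {π : Submodule K V} {P : ℙ K V} (h : IsSingularHyperplane Q π P) :
    IsTangentHyperplane Q P.rep N.rep π where
  nonsingular := hQ
  map_nucleus := hN.map_rep_ne_zero
  polar_nucleus := hN.polar_rep_eq_zero
  ne_zero := P.rep_nonzero
  map_vertex := h.map_rep
  mem_iff v := by
    refine ⟨fun hv => h.polar_rep_eq_zero hv, fun hv => ?_⟩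
    by_contra hvπ
    obtain ⟨w, hw⟩ := hQ P.rep P.rep_nonzero h.map_rep
    obtain ⟨c, hc, -⟩ := h.1.exists_sub_smul_mem (Submodule.mem_top : v ∈ ⊤) hvπ
      (Submodule.mem_top : w ∈ ⊤)
    have := h.polar_rep_eq_zero hc
    rw [QuadraticMap.polar_sub_right, QuadraticMap.polar_smul_right, hv, smul_zero,
      sub_zero] at this
    exact hw this

end Tangent

/-! ### Zeros of Q in hyperplanes, inside and outside π. -/

section SectionCounts

variable {K V : Type*} [Field K] [AddCommGroup V] [Module K V] {Q : QuadraticForm K V} {p n : V}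
  {π : Submodule K V}

namespace IsTangentHyperplane

theorem nucleus_mem (h : IsTangentHyperplane Q p n π) : n ∈ π := by
  rw [h.mem_iff, QuadraticMap.polar_comm, h.polar_nucleus]

theorem vertex_mem [CharP K 2] (h : IsTangentHyperplane Q p n π) : p ∈ π := by
  rw [h.mem_iff, polar_self_eq_zero]

theorem exists_functional (h : IsTangentHyperplane Q p n π) :
    ∃ f : Module.Dual K V, f ≠ 0 ∧ f.ker = π := by
  refine ⟨QuadraticMap.polarBilin Q p, ?_, ?_⟩
  · obtain ⟨w, hw⟩ := h.nonsingular p h.ne_zero h.map_vertex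
    exact fun h0 => hw (LinearMap.congr_fun h0 w)
  · ext v
    rw [LinearMap.mem_ker, h.mem_iff]
    rfl

variable [Finite K] [Finite V]

omit [Finite K] in
theorem isHyperplaneOf_top (h : IsTangentHyperplane Q p n π) : IsHyperplaneOf π ⊤ := by
  obtain ⟨f, hf, rfl⟩ := h.exists_functional
  exact isHyperplaneOf_ker hf

/-- Along direction n the form is Q(b) + t²Q(n), and squaring is bijective, so each affine line in
this direction has exactly one zero. -/
theorem card_mul_ncard_zeros_of_nucleus_mem [CharP K 2] (h : IsTangentHyperplane Q p n π)
    {W : Submodule K V} (hW : n ∈ W) :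
    Nat.card K * ({v | Q v = 0} ∩ W : Set V).ncard = (W : Set V).ncard := by
  refine card_mul_ncard_of_translate n _ _
    (fun a ha t => W.add_mem ha.2 (W.smul_mem _ hW)) fun b hb => ?_
  have hQ (t : K) : Q (b - t • n) = Q b + t ^ 2 * Q n := by
    rw [QuadraticMap.map_sub_smul, QuadraticMap.polar_comm, h.polar_nucleus, mul_zero, sub_zero]
  obtain ⟨t, ht⟩ := exists_sq_eq_of_charP_two (Q b / Q n)
  have hn := h.map_nucleus
  refine ⟨t, ⟨?_, W.sub_mem hb (W.smul_mem _ hW)⟩, fun s hs => ?_⟩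
  · change Q (b - t • n) = 0
    rw [hQ, ht, div_mul_cancel₀ _ hn, CharTwo.add_self_eq_zero]
  · have hs' : Q (b - s • n) = 0 := hs.1
    rw [hQ] at hs'
    apply sq_injective_of_charP_two
    rw [ht, eq_div_iff hn, ← sub_eq_zero, CharTwo.sub_eq_add, add_comm, hs']

/-- Off π the form is affine and nonconstant along direction p, so each affine line in this
direction has exactly one zero. -/
theorem card_mul_ncard_zeros_diff_of_vertex_mem [CharP K 2] (h : IsTangentHyperplane Q p n π)
    {W : Submodule K V} (hW : p ∈ W) :
    Nat.card K * ({v | Q v = 0} ∩ (W \ π) : Set V).ncard = (W \ π : Set V).ncard := by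
  refine card_mul_ncard_of_translate p _ _ (fun a ha t => ⟨W.add_mem ha.2.1 (W.smul_mem _ hW),
    fun hat => ha.2.2 ?_⟩) fun b hb => ?_
  · exact (π.add_mem_iff_left (π.smul_mem t h.vertex_mem)).1 hat
  have hB : QuadraticMap.polar Q b p ≠ 0 := fun h0 =>
    hb.2 ((h.mem_iff b).2 (by rw [QuadraticMap.polar_comm, h0]))
  have hQ (t : K) : Q (b - t • p) = Q b - t * QuadraticMap.polar Q b p := by
    rw [QuadraticMap.map_sub_smul, h.map_vertex, mul_zero, add_zero]
  refine ⟨Q b / QuadraticMap.polar Q b p, ⟨?_, W.sub_mem hb.1 (W.smul_mem _ hW), fun hat => ?_⟩,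
    fun s hs => ?_⟩
  · change Q _ = 0
    rw [hQ, div_mul_cancel₀ _ hB, sub_self]
  · exact hb.2 ((π.sub_mem_iff_left (π.smul_mem _ h.vertex_mem)).1 hat)
  · have hs' : Q (b - s • p) = 0 := hs.1
    rw [hQ, sub_eq_zero] at hs'
    rw [eq_div_iff hB, hs']

/-- On π the form is constant along direction p, and ν is a transversal to that direction. -/
theorem card_mul_ncard_zeros_of_vertex_notMem [CharP K 2] (h : IsTangentHyperplane Q p n π)
    {ν : Submodule K V} (hν : IsHyperplaneOf ν π) (hp : p ∉ ν) :
    Nat.card K * ({v | Q v = 0} ∩ ν : Set V).ncard = ({v | Q v = 0} ∩ π : Set V).ncard := by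
  have hQ (v : V) (hv : v ∈ π) (t : K) : Q (v + t • p) = Q v := by
    rw [QuadraticMap.map_add_smul, h.map_vertex, QuadraticMap.polar_comm, (h.mem_iff v).1 hv]
    ring
  refine card_mul_ncard_of_translate p _ _ (fun a ha t =>
    ⟨(hQ a (hν.1 ha.2) t).trans ha.1, π.add_mem (hν.1 ha.2) (π.smul_mem _ h.vertex_mem)⟩)
    fun b hb => ?_
  obtain ⟨c, hc, huniq⟩ := hν.exists_sub_smul_mem h.vertex_mem hp hb.2
  refine ⟨c, ⟨?_, hc⟩, fun s hs => huniq s hs.2⟩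
  change Q _ = 0
  rw [sub_eq_add_neg, ← neg_smul, hQ b hb.2]
  exact hb.1

variable {r : ℕ}

theorem ncard_zeros_of_nucleus_mem [CharP K 2] (h : IsTangentHyperplane Q p n π)
    {W : Submodule K V} (hW : n ∈ W) {d : ℕ} (hd : Module.finrank K W = d + 1) :
    ({v | Q v = 0} ∩ W : Set V).ncard = Nat.card K ^ d := by
  have := h.card_mul_ncard_zeros_of_nucleus_mem hW
  rw [ncard_submodule, hd, pow_succ'] at this
  exact Nat.eq_of_mul_eq_mul_left Nat.card_pos this

omit [Finite K] in
theorem finrank_eq (h : IsTangentHyperplane Q p n π) (hV : Module.finrank K V = 2 * r + 3) :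
    Module.finrank K π = 2 * r + 2 := by
  have := h.isHyperplaneOf_top.2
  rw [finrank_top, hV] at this
  omega

omit [Finite K] in
theorem finrank_of_isHyperplaneOf (h : IsTangentHyperplane Q p n π)
    (hV : Module.finrank K V = 2 * r + 3) {ν : Submodule K V} (hν : IsHyperplaneOf ν π) :
    Module.finrank K ν = 2 * r + 1 := by
  have := h.finrank_eq hV
  have := hν.2
  omega

theorem ncard_zeros_hyperplane_of_vertex_notMem [CharP K 2] (h : IsTangentHyperplane Q p n π)
    (hV : Module.finrank K V = 2 * r + 3) {ν : Submodule K V} (hν : IsHyperplaneOf ν π)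
    (hp : p ∉ ν) : ({v | Q v = 0} ∩ ν : Set V).ncard = Nat.card K ^ (2 * r) := by
  have h1 := h.card_mul_ncard_zeros_of_vertex_notMem hν hp
  rw [h.ncard_zeros_of_nucleus_mem h.nucleus_mem (h.finrank_eq hV), pow_succ'] at h1
  exact Nat.eq_of_mul_eq_mul_left Nat.card_pos h1

omit [Finite K] in
theorem ncard_zeros_inter_diff (H : Submodule K V) :
    (({v | Q v = 0} ∩ (H \ π) : Set V).ncard : ℤ) =
      ({v | Q v = 0} ∩ H : Set V).ncard - ({v | Q v = 0} ∩ (H ⊓ π : Submodule K V) : Set V).ncard := by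
  have h1 := Set.ncard_inter_add_ncard_sdiff_eq_ncard ({v | Q v = 0} ∩ H : Set V) π (Set.toFinite _)
  have h2 : ({v | Q v = 0} ∩ H : Set V) ∩ π = {v | Q v = 0} ∩ (H ⊓ π : Submodule K V) := by
    rw [Submodule.coe_inf, Set.inter_assoc]
  have h3 : ({v | Q v = 0} ∩ H : Set V) \ π = {v | Q v = 0} ∩ (H \ π) := Set.inter_sdiff_assoc _ _ _
  rw [h2, h3] at h1
  omega

theorem ncard_zeros_diff_of_mem [CharP K 2] (h : IsTangentHyperplane Q p n π)
    (hV : Module.finrank K V = 2 * r + 3) {H : Submodule K V} (hH : IsHyperplaneOf H ⊤)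
    (hne : H ≠ π) (hpn : p ∈ H ∨ n ∈ H) :
    (({v | Q v = 0} ∩ (H \ π) : Set V).ncard : ℤ) =
      ((Nat.card K : ℤ) - 1) * (Nat.card K : ℤ) ^ (2 * r) := by
  have hν := hH.inf h.isHyperplaneOf_top hne
  have hH' : Module.finrank K H = 2 * r + 2 := by
    have := hH.2
    rw [finrank_top, hV] at this
    omega
  rcases hpn with hp | hn
  · have h1 := h.card_mul_ncard_zeros_diff_of_vertex_mem hp
    have h2 := Set.ncard_inter_add_ncard_sdiff_eq_ncard (H : Set V) π (Set.toFinite _)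
    rw [← Submodule.coe_inf, ncard_submodule, ncard_submodule, h.finrank_of_isHyperplaneOf hV hν,
      hH', ← h1] at h2
    have hq : (Nat.card K : ℤ) ≠ 0 := by exact_mod_cast (Nat.card_pos (α := K)).ne'
    apply mul_left_cancel₀ hq
    zify at h2
    linear_combination h2
  · rw [ncard_zeros_inter_diff, h.ncard_zeros_of_nucleus_mem hn hH',
      h.ncard_zeros_of_nucleus_mem (Submodule.mem_inf.2 ⟨hn, h.nucleus_mem⟩) (h.finrank_of_isHyperplaneOf hV hν)]
    push_cast
    ring

/-- The polar form is nondegenerate on H. A vector v of H orthogonal to H is orthogonal to H + Kn =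
V; subtracting the multiple cn with c² = Q(v)/Q(n) gives a singular vector, which must be 0, and n ∉
H forces c = 0. So the exponential sum on H is ±q^(r+1). -/
theorem ncard_zeros_of_nucleus_notMem [CharP K 2] (h : IsTangentHyperplane Q p n π)
    (hV : Module.finrank K V = 2 * r + 3) {H : Submodule K V} (hH : IsHyperplaneOf H ⊤)
    (hn : n ∉ H) :
    ∃ ε : ℤ, (ε = 1 ∨ ε = -1) ∧ (({v | Q v = 0} ∩ H : Set V).ncard : ℤ) =
      (Nat.card K : ℤ) ^ (2 * r + 1) + ε * (((Nat.card K : ℤ) - 1) * (Nat.card K : ℤ) ^ r) := by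
  obtain ⟨χ, hχ⟩ := exists_addChar_ne_one K
  have hH' : Module.finrank K H = 2 * r + 2 := by
    have := hH.2
    rw [finrank_top, hV] at this
    omega
  have hcard : Nat.card H = Nat.card K ^ (2 * r + 2) := by
    rw [Module.natCard_eq_pow_finrank (K := K), hH']
  have hnd : ∀ v : H, (∀ w, QuadraticMap.polar (Q.comp H.subtype) v w = 0) → v = 0 := by
    intro v hv
    have hv' (w : V) : QuadraticMap.polar Q v w = 0 := by
      obtain ⟨c, hc, -⟩ := hH.exists_sub_smul_mem (Submodule.mem_top : n ∈ ⊤) hn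
        (Submodule.mem_top : w ∈ ⊤)
      have h1 : QuadraticMap.polar Q v (w - c • n) = 0 := hv ⟨_, hc⟩
      rwa [QuadraticMap.polar_sub_right, QuadraticMap.polar_smul_right,
        QuadraticMap.polar_comm _ _ n, h.polar_nucleus, smul_zero, sub_zero] at h1
    obtain ⟨c, hc⟩ := exists_sq_eq_of_charP_two (Q v / Q n)
    have hu : (v : V) - c • n = 0 := by
      by_contra hu
      obtain ⟨w, hw⟩ := h.nonsingular _ hu (by
        rw [QuadraticMap.map_sub_smul, hv', hc, div_mul_cancel₀ _ h.map_nucleus, mul_zero,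
          sub_zero, CharTwo.add_self_eq_zero])
      rw [QuadraticMap.polar_sub_left, QuadraticMap.polar_smul_left, hv', h.polar_nucleus] at hw
      simp at hw
    have hc0 : c = 0 := by
      by_contra hc0
      exact hn ((H.smul_mem_iff hc0).1 (by rw [← sub_eq_zero.1 hu]; exact v.2))
    simpa [hc0] using hu
  have hsq := charSum_sq_of_nondegenerate hχ (Q.comp H.subtype) hnd
  rw [hcard, show Nat.card K ^ (2 * r + 2) = (Nat.card K ^ (r + 1)) ^ 2 by ring, Nat.cast_pow,
    sq_eq_sq_iff_eq_or_eq_neg] at hsq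
  have himg : ({v | Q v = 0} ∩ H : Set V).ncard =
      (vectorCone (quadric (Q.comp H.subtype))).ncard := by
    rw [vectorCone_quadric, ← Set.ncard_image_of_injective _ H.subtype_injective]
    congr 1
    ext v
    simp [and_comm]
  have key (ε : ℤ) (hε : charSum χ (Q.comp H.subtype) = ε * (Nat.card K : ℂ) ^ (r + 1)) :=
    ncard_vectorCone_quadric_of_charSum K hχ (Q.comp H.subtype) (d := 2 * r + 1) hcard hε
  rw [himg]
  rcases hsq with hsq | hsq
  · exact ⟨1, Or.inl rfl, key 1 (by rw [hsq]; push_cast; ring)⟩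
  · exact ⟨-1, Or.inr rfl, key (-1) (by rw [hsq]; push_cast; ring)⟩

theorem ncard_zeros_diff_of_notMem [CharP K 2] (h : IsTangentHyperplane Q p n π)
    (hV : Module.finrank K V = 2 * r + 3) {H : Submodule K V} (hH : IsHyperplaneOf H ⊤)
    (hp : p ∉ H) (hn : n ∉ H) :
    ∃ ε : ℤ, (ε = 1 ∨ ε = -1) ∧
      (({v | Q v = 0} ∩ H : Set V).ncard : ℤ) =
        (Nat.card K : ℤ) ^ (2 * r + 1) + ε * (((Nat.card K : ℤ) - 1) * (Nat.card K : ℤ) ^ r) ∧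
      (({v | Q v = 0} ∩ (H \ π) : Set V).ncard : ℤ) =
        ((Nat.card K : ℤ) - 1) * (Nat.card K : ℤ) ^ (2 * r) +
          ε * (((Nat.card K : ℤ) - 1) * (Nat.card K : ℤ) ^ r) := by
  obtain ⟨ε, hε, hc⟩ := h.ncard_zeros_of_nucleus_notMem hV hH hn
  refine ⟨ε, hε, hc, ?_⟩
  have hne : H ≠ π := by rintro rfl; exact hn h.nucleus_mem
  rw [ncard_zeros_inter_diff, hc, h.ncard_zeros_hyperplane_of_vertex_notMem hV
    (hH.inf h.isHyperplaneOf_top hne) fun h0 => hp h0.1]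
  push_cast
  ring

omit [Finite K] in
/-- A hyperplane of `π` extends to a pencil of hyperplanes of the space that contains, besides `π`,
one member for each scalar; the members partition the vectors outside `π`. -/
theorem exists_pencil [CharP K 2] (h : IsTangentHyperplane Q p n π) {ν : Submodule K V}
    (hν : IsHyperplaneOf ν π) :
    ∃ H : K → Submodule K V, (∀ t, IsHyperplaneOf (H t) ⊤ ∧ H t ⊓ π = ν) ∧
      ∀ v ∉ π, ∃! t, v ∈ H t := by
  obtain ⟨f, hf, hfπ⟩ := h.exists_functional
  obtain ⟨u, huπ, huν⟩ := SetLike.exists_of_lt (lt_of_le_of_ne hν.1 hν.ne)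
  obtain ⟨g, hgu, hgν⟩ := Submodule.exists_le_ker_of_notMem huν
  have hfv (v : V) : f v = 0 ↔ v ∈ π := by rw [← hfπ, LinearMap.mem_ker]
  -- Here f defines π, while g vanishes on ν but not on π; the member through v outside π has
  -- parameter g(v)/f(v).
  refine ⟨fun t => (g - t • f).ker, fun t => ⟨isHyperplaneOf_ker fun h0 => hgu ?_, ?_⟩, ?_⟩
  · have := LinearMap.congr_fun h0 u
    simpa [(hfv u).2 huπ] using this
  · ext v
    simp only [Submodule.mem_inf, LinearMap.mem_ker, LinearMap.sub_apply, LinearMap.smul_apply,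
      smul_eq_mul]
    constructor
    · rintro ⟨h1, hvπ⟩
      rw [(hfv v).2 hvπ, mul_zero, sub_zero] at h1
      obtain ⟨c, hc, -⟩ := hν.exists_sub_smul_mem huπ huν hvπ
      have h2 : g (v - c • u) = 0 := hgν hc
      rw [map_sub, map_smul, h1, zero_sub, neg_eq_zero, smul_eq_mul] at h2
      simpa [(mul_eq_zero.1 h2).resolve_right hgu] using hc
    · intro hv
      have h1 : g v = 0 := hgν hv
      exact ⟨by rw [h1, (hfv v).2 (hν.1 hv), mul_zero, sub_zero], hν.1 hv⟩
  · intro v hv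
    have hv0 : f v ≠ 0 := fun h0 => hv ((hfv v).1 h0)
    refine ⟨g v / f v, ?_, fun s hs => ?_⟩
    · simp [div_mul_cancel₀ _ hv0]
    · have : g v - s * f v = 0 := hs
      rw [eq_div_iff hv0, sub_eq_zero.1 this]

/-- An averaging argument. The q hyperplanes other than π through ν partition the zeros outside π,
whose total is q(q-1)q^(2r). If all of them had the same sign, the sum would be off by q(q-1)q^r. -/
theorem exists_section_of_sign [CharP K 2] (h : IsTangentHyperplane Q p n π)
    (hV : Module.finrank K V = 2 * r + 3) {ν : Submodule K V} (hν : IsHyperplaneOf ν π)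
    (hp : p ∉ ν) (hn : n ∉ ν) {ε : ℤ} (hε : ε = 1 ∨ ε = -1) :
    ∃ H : Submodule K V, IsHyperplaneOf H ⊤ ∧ H ⊓ π = ν ∧
      (({v | Q v = 0} ∩ (H \ π) : Set V).ncard : ℤ) =
        ((Nat.card K : ℤ) - 1) * (Nat.card K : ℤ) ^ (2 * r) +
          ε * (((Nat.card K : ℤ) - 1) * (Nat.card K : ℤ) ^ r) := by
  have := Fintype.ofFinite K
  obtain ⟨H, hH, huniq⟩ := h.exists_pencil hν
  have hpH (t : K) : p ∉ H t := fun h0 => hp ((hH t).2 ▸ ⟨h0, h.vertex_mem⟩)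
  have hnH (t : K) : n ∉ H t := fun h0 => hn ((hH t).2 ▸ ⟨h0, h.nucleus_mem⟩)
  by_contra! hcon
  have hall (t : K) : (({v | Q v = 0} ∩ (H t \ π) : Set V).ncard : ℤ) =
        ((Nat.card K : ℤ) - 1) * (Nat.card K : ℤ) ^ (2 * r) -
          ε * (((Nat.card K : ℤ) - 1) * (Nat.card K : ℤ) ^ r) := by
    obtain ⟨δ, hδ, -, hc⟩ := h.ncard_zeros_diff_of_notMem hV (hH t).1 (hpH t) (hnH t)
    have := hcon (H t) (hH t).1 (hH t).2
    have hδε : δ = -ε := by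
      rcases hδ with rfl | rfl <;> rcases hε with rfl | rfl <;> simp_all
    rw [hc, hδε]
    ring
  have hsum : ({v | Q v = 0} ∩ ((⊤ : Submodule K V) \ π) : Set V).ncard =
      ∑ t : K, ({v | Q v = 0} ∩ (H t \ π) : Set V).ncard := by
    have hU : ({v | Q v = 0} ∩ ((⊤ : Submodule K V) \ π) : Set V) =
        ⋃ t ∈ (Finset.univ : Finset K), ({v | Q v = 0} ∩ (H t \ π) : Set V) := by
      ext v
      simp only [Finset.mem_univ, Set.iUnion_true, Set.mem_iUnion, Set.mem_inter_iff,
        Set.mem_sdiff, SetLike.mem_coe, Submodule.mem_top, true_and]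
      constructor
      · rintro ⟨h1, h2⟩
        obtain ⟨t, ht, -⟩ := huniq v h2
        exact ⟨t, h1, ht, h2⟩
      · rintro ⟨t, h1, ht, h2⟩
        exact ⟨h1, h2⟩
    rw [hU, ← finsum_mem_coe_finset, ← Set.Finite.ncard_biUnion (Set.toFinite _)
      (fun _ _ => Set.toFinite _)]
    · rfl
    · intro s _ t _ hst
      refine Set.disjoint_left.2 fun v hs ht => hst ?_
      exact (huniq v hs.2.2).unique hs.2.1 ht.2.1
  have htop : (({v | Q v = 0} ∩ ((⊤ : Submodule K V) \ π) : Set V).ncard : ℤ) =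
      (Nat.card K : ℤ) ^ (2 * r + 2) - (Nat.card K : ℤ) ^ (2 * r + 1) := by
    rw [ncard_zeros_inter_diff, top_inf_eq,
      h.ncard_zeros_of_nucleus_mem Submodule.mem_top (by rw [finrank_top, hV]),
      h.ncard_zeros_of_nucleus_mem h.nucleus_mem (h.finrank_eq hV)]
    push_cast
    ring
  rw [hsum, Nat.cast_sum, Finset.sum_congr rfl fun t _ => hall t, Finset.sum_const,
    Finset.card_univ, ← Nat.card_eq_fintype_card, nsmul_eq_mul] at htop
  have hq : (1 : ℤ) < Nat.card K := by exact_mod_cast Finite.one_lt_card (α := K)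
  have hpos : 0 < (Nat.card K : ℤ) * (((Nat.card K : ℤ) - 1) * (Nat.card K : ℤ) ^ r) := by
    have : 0 < (Nat.card K : ℤ) - 1 := by linarith
    positivity
  have hz : ε * ((Nat.card K : ℤ) * (((Nat.card K : ℤ) - 1) * (Nat.card K : ℤ) ^ r)) = 0 := by
    linear_combination -htop
  rcases mul_eq_zero.1 hz with h0 | h0
  · rcases hε with rfl | rfl <;> simp at h0
  · exact hpos.ne' h0

end IsTangentHyperplane

end SectionCounts

/-! ### Fourier analysis of the indicator function. -/

section SecondDifference

variable {K V : Type*} [Field K] [Finite K] [AddCommGroup V] [Module K V] [Finite V]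

/-- A cone that meets every hyperplane missing both `p` and `n` in the expected number of vectors
has an indicator function whose mixed second differences in the directions `p`, `n` vanish. -/
theorem indicator_second_difference (T : Set V) (p n : V)
    (hT : ∀ c : K, c ≠ 0 → ∀ v, c • v ∈ T ↔ v ∈ T)
    (hcard : ∀ f : Module.Dual K V, f p ≠ 0 → f n ≠ 0 →
      Nat.card K * (T ∩ f.ker : Set V).ncard = T.ncard) (x : V) (s t : K) :
    T.indicator (1 : V → ℂ) (x + s • p + t • n) + T.indicator (1 : V → ℂ) x =
      T.indicator (1 : V → ℂ) (x + s • p) + T.indicator (1 : V → ℂ) (x + t • n) := by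
  classical
  have := Fintype.ofFinite K
  have := Fintype.ofFinite V
  have := Fintype.ofFinite (Module.Dual K V)
  obtain ⟨χ, hχ⟩ := exists_addChar_ne_one K
  set φ : V → ℂ := T.indicator 1 with hφ
  have hsum (U : Set V) : ∑ v, U.indicator (1 : V → ℂ) v = U.ncard := by
    simp only [Set.indicator, Pi.one_apply, Finset.sum_boole, Set.ncard_eq_toFinset_card']
    congr 2
    ext v
    simp
  let F : Module.Dual K V → ℂ := fun f => ∑ v, φ v * χ (f v)
  -- Since T is a cone, all nonzero multiples of f have the same Fourier coefficient. The sum over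
  -- all multiples is q|T ∩ ker f| = |T|, which the zero multiple supplies alone.
  have hF (f : Module.Dual K V) (hp : f p ≠ 0) (hn : f n ≠ 0) : F f = 0 := by
    have h1 : ∑ c : K, ∑ v, φ v * χ (c * f v) = T.ncard := by
      rw [Finset.sum_comm]
      simp_rw [← Finset.mul_sum, sum_addChar_mul hχ]
      rw [← hcard f hp hn, Nat.cast_mul, ← hsum, Finset.mul_sum]
      refine Finset.sum_congr rfl fun v _ => ?_
      by_cases hv : v ∈ T <;> by_cases hfv : f v = 0 <;> simp [φ, Set.indicator, hv, hfv]
    have h2 (c : K) (hc : c ≠ 0) : ∑ v, φ v * χ (c * f v) = F f := by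
      refine Fintype.sum_equiv (LinearEquiv.smulOfNeZero K V c hc).toEquiv _ _ fun v => ?_
      have : φ (c • v) = φ v := by simp only [φ, Set.indicator, hT c hc]; rfl
      simp [this]
    rw [← Finset.add_sum_erase _ _ (Finset.mem_univ 0),
      Finset.sum_congr rfl fun c hc => h2 c (Finset.ne_of_mem_erase hc), Finset.sum_const] at h1
    simp only [zero_mul, AddChar.map_zero_eq_one, mul_one, φ, hsum, add_eq_left,
      nsmul_eq_mul, mul_eq_zero, Nat.cast_eq_zero] at h1
    refine h1.resolve_left ?_
    rw [Finset.card_erase_of_mem (Finset.mem_univ _), Finset.card_univ]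
    have := Fintype.one_lt_card (α := K)
    omega
  have hinv (y : V) : ∑ f, F f * χ (-f y) = Nat.card V * φ y := by
    simp_rw [F, Finset.sum_mul, mul_assoc, ← AddChar.map_add_eq_mul, ← sub_eq_add_neg, ← map_sub]
    rw [Finset.sum_comm]
    simp_rw [← Finset.mul_sum, sum_dual_addChar hχ, sub_eq_zero]
    rw [Finset.sum_eq_single y (fun v _ hv => by simp [hv]) (by simp)]
    simp [mul_comm]
  have hV : (Nat.card V : ℂ) ≠ 0 := by exact_mod_cast (Nat.card_pos (α := V)).ne'
  apply mul_left_cancel₀ hV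
  rw [mul_add, mul_add, ← hinv, ← hinv, ← hinv, ← hinv, ← Finset.sum_add_distrib,
    ← Finset.sum_add_distrib]
  refine Finset.sum_congr rfl fun f _ => ?_
  -- After Fourier inversion the identity is checked character by character: if f kills p or n, the
  -- mixed second difference of its character is zero; otherwise its coefficient is.
  by_cases hp : f p = 0
  · simp [hp, add_comm]
  by_cases hn : f n = 0
  · simp [hn]
  simp [hF f hp hn]

end SecondDifference

/-! ### From vanishing second differences to ruling directions. -/

section Directions

variable {K V : Type*} [Field K] [AddCommGroup V] [Module K V]

/-- The mixed second differences of the indicator function of `T` in the directions `p` and `n`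
vanish. -/
def IsGridAdditive (K : Type*) {V : Type*} [Field K] [AddCommGroup V] [Module K V]
    (T : Set V) (p n : V) : Prop :=
  ∀ (x : V) (s t : K),
    T.indicator (1 : V → ℂ) (x + s • p + t • n) + T.indicator (1 : V → ℂ) x =
      T.indicator (1 : V → ℂ) (x + s • p) + T.indicator (1 : V → ℂ) (x + t • n)

/-- On the coset of `⟨p, n⟩` through `x`, the set `T` is a union of cosets of `⟨p⟩`. -/
def IsRuled (K : Type*) {V : Type*} [Field K] [AddCommGroup V] [Module K V]
    (T : Set V) (p n x : V) : Prop :=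
  ∀ s t : K, x + s • p + t • n ∈ T ↔ x + t • n ∈ T

/-- If a step along p and a step along n both changed the indicator, their combination would take
the value 2 or -1. So at x one of the directions never changes it, and additivity carries this to
the whole coset. -/
theorem IsGridAdditive.isRuled_or {T : Set V} {p n : V} (h : IsGridAdditive K T p n) (x : V) :
    IsRuled K T p n x ∨ IsRuled K T n p x := by
  have key (s t : K) : (x + s • p ∈ T ↔ x ∈ T) ∨ (x + t • n ∈ T ↔ x ∈ T) := by
    have := h x s t
    by_cases h1 : x ∈ T <;> by_cases h2 : x + s • p ∈ T <;> by_cases h3 : x + t • n ∈ T <;>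
      by_cases h4 : x + s • p + t • n ∈ T <;> simp_all [Set.indicator]; norm_num at this
  by_cases hp : ∀ s : K, x + s • p ∈ T ↔ x ∈ T
  · left
    intro s t
    have := h x s t
    have hs := hp s
    by_cases h1 : x ∈ T <;> by_cases h3 : x + t • n ∈ T <;>
      by_cases h4 : x + s • p + t • n ∈ T <;> simp_all [Set.indicator]
  · right
    push Not at hp
    obtain ⟨s₀, hs₀⟩ := hp
    intro t s
    have ht : x + t • n ∈ T ↔ x ∈ T := (key s₀ t).resolve_left (by tauto)
    have := h x s t
    rw [add_right_comm]
    by_cases h1 : x ∈ T <;> by_cases h3 : x + s • p ∈ T <;>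
      by_cases h4 : x + s • p + t • n ∈ T <;> simp_all [Set.indicator]

theorem IsRuled.translate {T : Set V} {p n x : V} (h : IsRuled K T p n x) (a b : K) :
    IsRuled K T p n (x + a • p + b • n) := by
  intro s t
  have h1 := h (a + s) (b + t)
  have h2 := h a (b + t)
  rw [show x + a • p + b • n + s • p + t • n = x + (a + s) • p + (b + t) • n by module,
    show x + a • p + b • n + t • n = x + a • p + (b + t) • n by module, h1, h2]

theorem IsRuled.smul {T : Set V} (hT : ∀ c : K, c ≠ 0 → ∀ v, c • v ∈ T ↔ v ∈ T) {p n x : V}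
    (h : IsRuled K T p n x) {c : K} (hc : c ≠ 0) : IsRuled K T p n (c • x) := by
  intro s t
  have h1 := h (c⁻¹ * s) (c⁻¹ * t)
  rw [← hT c hc, ← hT c hc (x + _), smul_add, smul_add, smul_add, smul_smul, smul_smul,
    mul_inv_cancel_left₀ hc, mul_inv_cancel_left₀ hc] at h1
  exact h1

/-- Makes the choice of ruling direction depend only on the projective plane spanned by PN and the
point of x, so that the resulting lines are consistent. -/
theorem isRuled_smul_add_iff {T : Set V} (hT : ∀ c : K, c ≠ 0 → ∀ v, c • v ∈ T ↔ v ∈ T)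
    {p n x : V} {c : K} (hc : c ≠ 0) (a b : K) :
    IsRuled K T p n (c • x + a • p + b • n) ↔ IsRuled K T p n x := by
  refine ⟨fun h => ?_, fun h => (h.smul hT hc).translate a b⟩
  have h1 := (h.translate (-a) (-b)).smul hT (inv_ne_zero hc)
  convert h1 using 1
  rw [show c • x + a • p + b • n + -a • p + -b • n = c • x by module, inv_smul_smul₀ hc]

end Directions

/-! ### Traces of a switched quasi-quadric on hyperplanes of π. -/

section QuasiQuadric

variable {K V : Type*} [Field K] [Finite K] [CharP K 2] [AddCommGroup V] [Module K V] [Finite V]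

omit [CharP K 2] in
theorem ncard_eq_iff_vectorCone (S : Set (ℙ K V)) (a : ℕ) {m : ℤ}
    (ha : ((Nat.card K : ℤ) - 1) * a + 1 = m) :
    S.ncard = a ↔ ((vectorCone S).ncard : ℤ) = m := by
  have hq : (Nat.card K : ℤ) - 1 ≠ 0 := by
    rw [sub_ne_zero]
    exact_mod_cast (Finite.one_lt_card (α := K)).ne'
  rw [int_ncard_vectorCone, ← ha, add_left_inj, mul_right_inj' hq, Nat.cast_inj]

/-- The signs -1, 0, 1 stand for the elliptic, cone and hyperbolic sizes, in this order. -/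
theorem isParabolicQuasiQuadric_iff (r : ℕ) (S : Set (ℙ K V)) :
    IsParabolicQuasiQuadric (r + 1) S ↔ ∀ H : Submodule K V, IsHyperplaneOf H ⊤ →
      ∃ ε : ℤ, (ε = -1 ∨ ε = 0 ∨ ε = 1) ∧ ((vectorCone S ∩ H : Set V).ncard : ℤ) =
        (Nat.card K : ℤ) ^ (2 * r + 1) + ε * (((Nat.card K : ℤ) - 1) * (Nat.card K : ℤ) ^ r) := by
  refine forall₂_congr fun H _ => ?_
  rw [Nat.add_sub_cancel, ncard_eq_iff_vectorCone _ _ (ncard_quadric_ellipticForm K r),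
    ncard_eq_iff_vectorCone _ _ (ncard_quadric_coneForm_parabolicForm K r),
    ncard_eq_iff_vectorCone _ _ (ncard_quadric_hyperbolicForm K r), vectorCone_inter,
    vectorCone_pts]
  simp [or_and_right, exists_or]

theorem hasConelikeSections_iff (r : ℕ) (P N : ℙ K V) (π : Submodule K V) (S : Set (ℙ K V)) :
    HasConelikeSections (r + 2) P N π S ↔ ∀ ν : Submodule K V, IsHyperplaneOf ν π →
      P.rep ∈ ν ∨ N.rep ∈ ν →
      ∃ ε : ℤ, (ε = -1 ∨ ε = 0 ∨ ε = 1) ∧ ((vectorCone S ∩ ν : Set V).ncard : ℤ) =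
        (Nat.card K : ℤ) ^ (2 * (r + 1)) +
          ε * (((Nat.card K : ℤ) - 1) * (Nat.card K : ℤ) ^ (r + 1)) := by
  refine forall₂_congr fun ν _ => ?_
  rw [mem_pts_iff_rep, mem_pts_iff_rep, Nat.add_sub_cancel, show r + 2 - 1 = r + 1 from rfl,
    ncard_eq_iff_vectorCone _ _ (ncard_quadric_coneForm_ellipticForm K r),
    ncard_eq_iff_vectorCone _ _ (ncard_quadric_parabolicForm K (r + 1)),
    ncard_eq_iff_vectorCone _ _ (ncard_quadric_coneForm_hyperbolicForm K (r + 1)),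
    vectorCone_inter, vectorCone_pts]
  simp [or_and_right, exists_or, mul_add]

variable {Q : QuadraticForm K V} {p n : V} {π : Submodule K V} {S : Set (ℙ K V)}

omit [Finite K] [CharP K 2] in
theorem ncard_vectorCone_inter_of_eq_off (hS : vectorCone S \ π = {v | Q v = 0} \ π)
    (H : Submodule K V) :
    ((vectorCone S ∩ H : Set V).ncard : ℤ) =
      ({v | Q v = 0} ∩ (H \ π) : Set V).ncard +
        (vectorCone S ∩ (H ⊓ π : Submodule K V) : Set V).ncard := by
  have h1 := Set.ncard_inter_add_ncard_sdiff_eq_ncard (vectorCone S ∩ H : Set V) π (Set.toFinite _)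
  have h2 : (vectorCone S ∩ H : Set V) ∩ π = vectorCone S ∩ (H ⊓ π : Submodule K V) := by
    rw [Submodule.coe_inf, Set.inter_assoc]
  have h3 : (vectorCone S ∩ H : Set V) \ π = {v | Q v = 0} ∩ (H \ π) := by
    rw [← Set.inter_sdiff_assoc, Set.inter_comm, Set.inter_sdiff_assoc, hS, Set.inter_comm _ (H : Set V),
      Set.inter_sdiff_assoc]
  rw [h2, h3] at h1
  omega

omit [CharP K 2] in
theorem ncard_vectorCone_inter_eq_of_eq_off
    (hS : vectorCone S \ π = {v | Q v = 0} \ π) (hcard : S.ncard = (quadric Q).ncard) :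
    (vectorCone S ∩ π : Set V).ncard = ({v | Q v = 0} ∩ π : Set V).ncard := by
  have h1 := card_sub_one_mul_ncard_add_one S
  rw [hcard, card_sub_one_mul_ncard_add_one, vectorCone_quadric,
    ← Set.ncard_inter_add_ncard_sdiff_eq_ncard _ (π : Set V) (Set.toFinite _),
    ← Set.ncard_inter_add_ncard_sdiff_eq_ncard (vectorCone S) (π : Set V) (Set.toFinite _), hS] at h1
  omega

namespace IsTangentHyperplane

variable {r : ℕ}

/-- Any one hyperplane H ≠ π through ν suffices: its part outside π has (q-1)q^(2r) vectors, and
subtracting this keeps the ε of H. -/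
theorem ncard_inter_of_mem (h : IsTangentHyperplane Q p n π)
    (hV : Module.finrank K V = 2 * r + 3) (hS : vectorCone S \ π = {v | Q v = 0} \ π)
    (hqq : IsParabolicQuasiQuadric (r + 1) S) {ν : Submodule K V} (hν : IsHyperplaneOf ν π)
    (hpn : p ∈ ν ∨ n ∈ ν) :
    ∃ ε : ℤ, (ε = -1 ∨ ε = 0 ∨ ε = 1) ∧ ((vectorCone S ∩ ν : Set V).ncard : ℤ) =
      (Nat.card K : ℤ) ^ (2 * r) + ε * (((Nat.card K : ℤ) - 1) * (Nat.card K : ℤ) ^ r) := by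
  obtain ⟨H, hH, -⟩ := h.exists_pencil hν
  obtain ⟨hH1, hH2⟩ := hH 0
  have hne : H 0 ≠ π := by
    intro he
    rw [he, inf_idem] at hH2
    exact hν.ne hH2.symm
  have hle : ν ≤ H 0 := hH2 ▸ inf_le_left
  obtain ⟨ε, hε, hc⟩ := (isParabolicQuasiQuadric_iff r S).1 hqq (H 0) hH1
  rw [ncard_vectorCone_inter_of_eq_off hS, hH2,
    h.ncard_zeros_diff_of_mem hV hH1 hne (hpn.imp (@hle p) (@hle n))] at hc
  exact ⟨ε, hε, by linear_combination hc⟩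

/-- Extending ν to a hyperplane of sign δ gives a deviation ε - δ from q^(2r). It is at most 0 for δ
= 1 and at least 0 for δ = -1; being the same number, it is 0. -/
theorem ncard_inter_of_notMem (h : IsTangentHyperplane Q p n π)
    (hV : Module.finrank K V = 2 * r + 3) (hS : vectorCone S \ π = {v | Q v = 0} \ π)
    (hqq : IsParabolicQuasiQuadric (r + 1) S) {ν : Submodule K V} (hν : IsHyperplaneOf ν π)
    (hp : p ∉ ν) (hn : n ∉ ν) : (vectorCone S ∩ ν : Set V).ncard = Nat.card K ^ (2 * r) := by
  have key (δ : ℤ) (hδ : δ = 1 ∨ δ = -1) :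
      ∃ ε : ℤ, (ε = -1 ∨ ε = 0 ∨ ε = 1) ∧ ((vectorCone S ∩ ν : Set V).ncard : ℤ) =
        (Nat.card K : ℤ) ^ (2 * r) +
          (ε - δ) * (((Nat.card K : ℤ) - 1) * (Nat.card K : ℤ) ^ r) := by
    obtain ⟨H, hH1, hH2, hc'⟩ := h.exists_section_of_sign hV hν hp hn hδ
    obtain ⟨ε, hε, hc⟩ := (isParabolicQuasiQuadric_iff r S).1 hqq H hH1
    rw [ncard_vectorCone_inter_of_eq_off hS, hH2, hc'] at hc
    exact ⟨ε, hε, by linear_combination hc⟩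
  obtain ⟨ε₁, hε₁, h₁⟩ := key 1 (Or.inl rfl)
  obtain ⟨ε₂, hε₂, h₂⟩ := key (-1) (Or.inr rfl)
  have hq : (1 : ℤ) < Nat.card K := by exact_mod_cast Finite.one_lt_card (α := K)
  have hpos : ((Nat.card K : ℤ) - 1) * (Nat.card K : ℤ) ^ r ≠ 0 :=
    mul_ne_zero (by linarith) (pow_ne_zero _ (by linarith))
  have heq : ε₁ - 1 = ε₂ - -1 := mul_right_cancel₀ hpos (by linear_combination h₂ - h₁)
  have hz : ε₁ - 1 = 0 := by omega
  rw [hz, zero_mul, add_zero] at h₁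
  exact_mod_cast h₁

theorem isGridAdditive (h : IsTangentHyperplane Q p n π)
    (hV : Module.finrank K V = 2 * r + 3) (hS : vectorCone S \ π = {v | Q v = 0} \ π)
    (hqq : IsParabolicQuasiQuadric (r + 1) S) (hcard : S.ncard = (quadric Q).ncard) :
    IsGridAdditive K (vectorCone S ∩ π : Set V) p n := by
  refine indicator_second_difference (K := K) _ p n (fun c hc v => ?_) fun f hp hn => ?_
  · simp [smul_mem_vectorCone_iff S hc, π.smul_mem_iff hc]
  have hf : IsHyperplaneOf f.ker ⊤ := isHyperplaneOf_ker (by rintro rfl; simp at hp)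
  have hν := hf.inf h.isHyperplaneOf_top (by rintro rfl; exact hp h.vertex_mem)
  have h1 := h.ncard_inter_of_notMem hV hS hqq hν (fun h0 => hp h0.1) (fun h0 => hn h0.1)
  rw [ncard_vectorCone_inter_eq_of_eq_off hS hcard, h.ncard_zeros_of_nucleus_mem h.nucleus_mem (h.finrank_eq hV),
    Set.inter_assoc, Set.inter_comm (π : Set V), ← Submodule.coe_inf, h1]
  ring

end IsTangentHyperplane

end QuasiQuadric

/-! ### Lines and truncated lines against subspaces. -/

section Lines

variable {K V : Type*} [Field K] [AddCommGroup V] [Module K V]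

theorem left_mem_pts_lineThrough (X Y : ℙ K V) : X ∈ pts (lineThrough X Y) :=
  (le_sup_left : X.submodule ≤ X.submodule ⊔ Y.submodule)

theorem right_mem_pts_lineThrough (X Y : ℙ K V) : Y ∈ pts (lineThrough X Y) :=
  (le_sup_right : Y.submodule ≤ X.submodule ⊔ Y.submodule)

theorem lineThrough_le {X Y : ℙ K V} {W : Submodule K V} (hX : X ∈ pts W) (hY : Y ∈ pts W) :
    lineThrough X Y ≤ W :=
  sup_le hX hY

theorem mem_lineThrough {X Y : ℙ K V} {v : V} :
    v ∈ lineThrough X Y ↔ ∃ a b : K, a • X.rep + b • Y.rep = v := by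
  rw [lineThrough, X.submodule_eq, Y.submodule_eq, ← Submodule.span_union, Set.singleton_union,
    Submodule.mem_span_pair]

theorem finrank_lineThrough {X Y : ℙ K V} (h : X ≠ Y) :
    Module.finrank K (lineThrough X Y) = 2 := by
  rw [lineThrough, X.submodule_eq, Y.submodule_eq, ← Submodule.span_union, Set.singleton_union]
  refine finrank_span_pair X.rep_nonzero fun hY => h ?_
  obtain ⟨c, hc⟩ := Submodule.mem_span_singleton.1 hY
  rw [← Y.mk_rep]
  exact ((mk_eq_iff_exists_smul_rep _ _ _).2 ⟨c, hc⟩).symm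

theorem eq_lineThrough {X Y : ℙ K V} (h : X ≠ Y) {l : Submodule K V}
    (hl : Module.finrank K l = 2) (hX : X ∈ pts l) (hY : Y ∈ pts l) : l = lineThrough X Y := by
  have : FiniteDimensional K l := Module.finite_of_finrank_pos (by omega)
  exact (Submodule.eq_of_le_of_finrank_eq (lineThrough_le hX hY)
    (by rw [finrank_lineThrough h, hl])).symm

variable [Finite K] [Finite V]

theorem card_sub_one_mul_ncard_pts_add_one (W : Submodule K V) :
    (Nat.card K - 1) * (pts W).ncard + 1 = Nat.card K ^ Module.finrank K W := by
  rw [card_sub_one_mul_ncard_add_one, vectorCone_pts, ncard_submodule]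

theorem ncard_pts_of_finrank_one {W : Submodule K V} (h : Module.finrank K W = 1) :
    (pts W).ncard = 1 := by
  have h1 := card_sub_one_mul_ncard_pts_add_one W
  obtain ⟨m, hm⟩ := Nat.exists_eq_add_of_lt (Finite.one_lt_card (α := K))
  rw [h, pow_one, hm, Nat.add_sub_cancel, Nat.add_right_cancel_iff] at h1
  exact Nat.eq_of_mul_eq_mul_left (Nat.succ_pos m) (by linarith)

theorem ncard_pts_of_finrank_two {W : Submodule K V} (h : Module.finrank K W = 2) :
    (pts W).ncard = Nat.card K + 1 := by
  have h1 := card_sub_one_mul_ncard_pts_add_one W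
  obtain ⟨m, hm⟩ := Nat.exists_eq_add_of_lt (Finite.one_lt_card (α := K))
  rw [h, hm, Nat.add_sub_cancel] at h1
  rw [hm]
  exact Nat.eq_of_mul_eq_mul_left (Nat.succ_pos m) (by linarith)

theorem IsTruncatedLine.ncard_eq {C : ℙ K V} {t : Set (ℙ K V)} (h : IsTruncatedLine C t) :
    t.ncard = Nat.card K := by
  obtain ⟨l, hl, hC, rfl⟩ := h
  rw [Set.ncard_sdiff_singleton_of_mem hC, ncard_pts_of_finrank_two hl, Nat.add_sub_cancel]

theorem IsTruncatedLine.nonempty {C : ℙ K V} {t : Set (ℙ K V)} (h : IsTruncatedLine C t) :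
    t.Nonempty := by
  rw [← Set.ncard_pos (Set.toFinite _), h.ncard_eq]
  exact Nat.card_pos

omit [Finite K] [Finite V] in
theorem IsTruncatedLine.subset_or_inter_eq_empty {C : ℙ K V} {t : Set (ℙ K V)}
    (h : IsTruncatedLine C t) {W : Submodule K V} (hC : C ∈ pts W) :
    t ⊆ pts W ∨ t ∩ pts W = ∅ := by
  obtain ⟨l, hl, hCl, rfl⟩ := h
  rw [or_iff_not_imp_right, ← Ne, ← Set.nonempty_iff_ne_empty]
  rintro ⟨X, ⟨hXl, hXC⟩, hXW⟩ Y hY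
  have hle : l ≤ W := eq_lineThrough (Ne.symm hXC) hl hCl hXl ▸ lineThrough_le hC hXW
  exact hY.1.trans hle

/-- A subspace through C contains all q points of the truncated line or none, so such lines
disappear from counts modulo q. -/
theorem IsTruncatedLine.card_dvd_ncard_inter {C : ℙ K V} {t : Set (ℙ K V)}
    (h : IsTruncatedLine C t) {W : Submodule K V} (hC : C ∈ pts W) :
    Nat.card K ∣ (t ∩ pts W).ncard := by
  rcases h.subset_or_inter_eq_empty hC with h1 | h1
  · rw [Set.inter_eq_left.2 h1, h.ncard_eq]
  · rw [h1, Set.ncard_empty]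
    exact dvd_zero _

omit [Finite K] in
theorem finrank_inf_of_isHyperplaneOf {ν W l : Submodule K V} (hν : IsHyperplaneOf ν W)
    (hl : Module.finrank K l = 2) (hlW : l ≤ W) (hlν : ¬ l ≤ ν) :
    Module.finrank K ↥(l ⊓ ν) = 1 := by
  have h1 := Submodule.finrank_sup_add_finrank_inf_eq l ν
  have h2 : Module.finrank K ν < Module.finrank K ↥(l ⊔ ν) :=
    Submodule.finrank_lt_finrank_of_lt (right_lt_sup.2 hlν)
  have h3 := Submodule.finrank_mono (sup_le hlW hν.1)
  have h4 := hν.2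
  omega

theorem IsTruncatedLine.ncard_inter_of_notMem {C : ℙ K V} {t : Set (ℙ K V)}
    (h : IsTruncatedLine C t) {ν W : Submodule K V} (hν : IsHyperplaneOf ν W) (hCW : C ∈ pts W)
    (htW : t ⊆ pts W) (hC : C ∉ pts ν) : (t ∩ pts ν).ncard = 1 := by
  obtain ⟨X, hX⟩ := h.nonempty
  obtain ⟨l, hl, hCl, rfl⟩ := h
  have hle : l ≤ W := by
    rw [eq_lineThrough (Ne.symm hX.2) hl hCl hX.1]
    exact lineThrough_le hCW (htW hX)
  have hset : (pts l \ {C}) ∩ pts ν = pts (l ⊓ ν) := by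
    ext Y
    simp only [pts, Set.mem_inter_iff, Set.mem_sdiff, Set.mem_ofPred_eq, le_inf_iff,
      Set.mem_singleton_iff]
    constructor
    · rintro ⟨⟨h1, -⟩, h2⟩
      exact ⟨h1, h2⟩
    · rintro ⟨h1, h2⟩
      exact ⟨⟨h1, fun he => hC (he ▸ h2)⟩, h2⟩
  rw [hset]
  exact ncard_pts_of_finrank_one
    (finrank_inf_of_isHyperplaneOf hν hl hle fun hlν => hC (hCl.trans hlν))

omit [Finite K] [Finite V] in
theorem ncard_sUnion_inter [Finite (ℙ K V)] {L : Set (Set (ℙ K V))} (hL : L.PairwiseDisjoint id)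
    (A : Set (ℙ K V)) : (⋃₀ L ∩ A).ncard = ∑ t ∈ L.toFinite.toFinset, (t ∩ A).ncard := by
  have hU : ⋃₀ L ∩ A = ⋃ t ∈ L, t ∩ A := by
    rw [Set.sUnion_eq_biUnion, Set.iUnion₂_inter]
  have hd : L.PairwiseDisjoint (fun t => t ∩ A) := fun s hs t ht hst =>
    (hL hs ht hst).mono Set.inter_subset_left Set.inter_subset_left
  rw [hU, Set.Finite.ncard_biUnion (Set.toFinite L) (fun _ _ => Set.toFinite _) hd,
    finsum_mem_eq_finite_toFinset_sum]

end Lines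

/-! ### Separating the line PN from the other truncated lines. -/

section TruncatedLineSets

variable {K V : Type*} [Field K] [AddCommGroup V] [Module K V]
  {P N : ℙ K V} {π : Submodule K V} {L : Set (Set (ℙ K V))}

theorem exists_mem_lineThrough_ne (hPN : P ≠ N) :
    ∃ X ∈ pts (lineThrough P N), X ≠ P ∧ X ≠ N := by
  have hli := (Projectivization.linearIndependent_pair_iff_ne).2 hPN
  rw [LinearIndependent.pair_iff] at hli
  have h0 : P.rep + N.rep ≠ 0 := fun h0 => one_ne_zero (hli 1 1 (by simpa using h0)).1
  refine ⟨Projectivization.mk K _ h0, (mk_mem_pts _ _ _).2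
    (mem_lineThrough.2 ⟨1, 1, by simp⟩), fun h => ?_, fun h => ?_⟩
  · obtain ⟨c, hc⟩ := (mk_eq_iff_exists_smul_rep _ _ _).1 h
    refine one_ne_zero (hli (1 - c) 1 ?_).2
    rw [sub_smul, hc]
    module
  · obtain ⟨c, hc⟩ := (mk_eq_iff_exists_smul_rep _ _ _).1 h
    refine one_ne_zero (hli 1 (1 - c) ?_).1
    rw [sub_smul, hc]
    module

theorem IsTruncatedLine.eq_of_subset_lineThrough {X Y : ℙ K V} (hXY : X ≠ Y)
    {t : Set (ℙ K V)} {C : ℙ K V} (h : IsTruncatedLine C t) (hC : C ∈ pts (lineThrough X Y))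
    {Z : ℙ K V} (hZ : Z ∈ t) (hZl : Z ∈ pts (lineThrough X Y)) :
    t = pts (lineThrough X Y) \ {C} := by
  obtain ⟨l, hl, hCl, rfl⟩ := h
  rw [eq_lineThrough (Ne.symm hZ.2) hl hCl hZ.1,
    eq_lineThrough (Ne.symm hZ.2) (finrank_lineThrough hXY) hC hZl]

namespace IsTruncatedLineSet

theorem exists_center (hL : IsTruncatedLineSet P N π L) {t : Set (ℙ K V)} (ht : t ∈ L) :
    ∃ C, (C = P ∨ C = N) ∧ C ∈ pts (lineThrough P N) ∧ IsTruncatedLine C t := by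
  rcases (hL.1 t ht).2 with h | h
  · exact ⟨P, Or.inl rfl, left_mem_pts_lineThrough P N, h⟩
  · exact ⟨N, Or.inr rfl, right_mem_pts_lineThrough P N, h⟩

theorem inter_lineThrough_eq_empty (hL : IsTruncatedLineSet P N π L) {t : Set (ℙ K V)}
    (ht : t ∈ L) (hsub : ¬ t ⊆ pts (lineThrough P N)) : t ∩ pts (lineThrough P N) = ∅ := by
  obtain ⟨C, -, hCl, hC⟩ := hL.exists_center ht
  exact (hC.subset_or_inter_eq_empty hCl).resolve_left hsub

theorem eq_of_subset_lineThrough [Finite K] [Finite V] (hL : IsTruncatedLineSet P N π L)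
    (hPN : P ≠ N) {t : Set (ℙ K V)} (ht : t ∈ L) (hsub : t ⊆ pts (lineThrough P N)) :
    t = pts (lineThrough P N) \ {P} ∨ t = pts (lineThrough P N) \ {N} := by
  obtain ⟨C, hCPN, hCl, hC⟩ := hL.exists_center ht
  obtain ⟨X, hX⟩ := hC.nonempty
  rw [hC.eq_of_subset_lineThrough hPN hCl hX (hsub hX)]
  rcases hCPN with rfl | rfl
  · exact Or.inl rfl
  · exact Or.inr rfl

/-- The members of a set of truncated lines off the line `PN` are pairwise disjoint, and at most
one member lies on `PN`. -/
theorem exists_decomposition [Finite K] [Finite V] (hL : IsTruncatedLineSet P N π L)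
    (hPN : P ≠ N) {S : Set (ℙ K V)}
    (hS : S = ⋃₀ L ∪ pts (lineThrough P N) ∨ S = ⋃₀ L ∪ {P} ∨ S = ⋃₀ L ∪ {N}) :
    ∃ (L' : Set (Set (ℙ K V))) (E : Set (ℙ K V)) (c : ℕ), L' ⊆ L ∧ L.ncard = L'.ncard + c ∧
      L'.PairwiseDisjoint id ∧ (∀ t ∈ L', t ∩ pts (lineThrough P N) = ∅) ∧ S = ⋃₀ L' ∪ E ∧
      E ⊆ pts (lineThrough P N) ∧
      ((c = 0 ∧ (E = pts (lineThrough P N) ∨ E = {P} ∨ E = {N})) ∨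
        (c = 1 ∧ (pts (lineThrough P N) \ {P} ⊆ E ∨ pts (lineThrough P N) \ {N} ⊆ E))) := by
  set A := pts (lineThrough P N) with hA
  have hPA : P ∈ A := left_mem_pts_lineThrough P N
  have hNA : N ∈ A := right_mem_pts_lineThrough P N
  obtain ⟨D, hDA, hDP, hDN⟩ := exists_mem_lineThrough_ne hPN
  set L₀ := {t ∈ L | t ⊆ A} with hL₀
  set L' := {t ∈ L | ¬ t ⊆ A} with hL'
  have hunion : L = L' ∪ L₀ := by
    ext t
    by_cases h : t ⊆ A <;> simp [L', L₀, h]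
  have hcard : L.ncard = L'.ncard + L₀.ncard := by
    conv_lhs => rw [hunion]
    exact Set.ncard_union_eq (Set.disjoint_left.2 fun t h1 h2 => h1.2 h2.2)
  have hdisj : ∀ t ∈ L', t ∩ A = ∅ := fun t ht => hL.inter_lineThrough_eq_empty ht.1 ht.2
  have hpd : L'.PairwiseDisjoint id := by
    intro s hs t ht hst
    refine Set.disjoint_left.2 fun X hXs hXt => ?_
    have hXA : X ∈ A := by
      rcases hL.2 s hs.1 t ht.1 hst ⟨hXs, hXt⟩ with rfl | rfl
      · exact hPA
      · exact hNA
    exact Set.notMem_empty X (hdisj s hs ▸ ⟨hXs, hXA⟩)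
  -- The two truncations of PN cannot both be members: they share the point D, which is neither P
  -- nor N.
  have hcases : L₀ = ∅ ∨ L₀ = {A \ {P}} ∨ L₀ = {A \ {N}} := by
    have hmem : ∀ t ∈ L₀, t = A \ {P} ∨ t = A \ {N} := fun t ht =>
      hL.eq_of_subset_lineThrough hPN ht.1 ht.2
    by_cases h1 : A \ {P} ∈ L₀
    · refine Or.inr (Or.inl (Set.eq_singleton_iff_unique_mem.2 ⟨h1, fun t ht => ?_⟩))
      refine (hmem t ht).resolve_right fun h2 => ?_
      subst h2
      have hne : A \ {P} ≠ A \ {N} := fun he => by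
        have : N ∈ A \ {P} := ⟨hNA, Ne.symm hPN⟩
        rw [he] at this
        exact this.2 rfl
      rcases hL.2 _ h1.1 _ ht.1 hne ⟨⟨hDA, hDP⟩, ⟨hDA, hDN⟩⟩ with h | h
      · exact hDP h
      · exact hDN h
    · by_cases h2 : A \ {N} ∈ L₀
      · refine Or.inr (Or.inr (Set.eq_singleton_iff_unique_mem.2 ⟨h2, fun t ht => ?_⟩))
        exact (hmem t ht).resolve_left fun h3 => h1 (h3 ▸ ht)
      · left
        rw [Set.eq_empty_iff_forall_notMem]
        intro t ht
        rcases hmem t ht with rfl | rfl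
        · exact h1 ht
        · exact h2 ht
  obtain ⟨B, hBA, hB, hSB⟩ : ∃ B ⊆ A, (B = A ∨ B = {P} ∨ B = {N}) ∧ S = ⋃₀ L ∪ B := by
    rcases hS with h | h | h
    · exact ⟨A, subset_rfl, Or.inl rfl, h⟩
    · exact ⟨{P}, Set.singleton_subset_iff.2 hPA, Or.inr (Or.inl rfl), h⟩
    · exact ⟨{N}, Set.singleton_subset_iff.2 hNA, Or.inr (Or.inr rfl), h⟩
  rw [hunion, Set.sUnion_union, Set.union_assoc] at hSB
  refine ⟨L', ⋃₀ L₀ ∪ B, L₀.ncard, fun t ht => ht.1, hcard, hpd, hdisj, hSB,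
    Set.union_subset (Set.sUnion_subset fun t ht => ht.2) hBA, ?_⟩
  rcases hcases with h0 | h0 | h0
  · left
    simpa [h0] using hB
  · right
    rw [h0, Set.ncard_singleton, Set.sUnion_singleton]
    exact ⟨rfl, Or.inl Set.subset_union_left⟩
  · right
    rw [h0, Set.ncard_singleton, Set.sUnion_singleton]
    exact ⟨rfl, Or.inr Set.subset_union_left⟩

end IsTruncatedLineSet

end TruncatedLineSets

/-! ### The converse: counting modulo q and verifying all hyperplanes. -/

section Converse

variable {K V : Type*} [Field K] [Finite K] [AddCommGroup V] [Module K V] [Finite V]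
  {P N : ℙ K V} {π : Submodule K V} {L : Set (Set (ℙ K V))}

omit [Finite K] in
theorem ncard_sUnion_union_inter {L' : Set (Set (ℙ K V))} {E A : Set (ℙ K V)}
    (hpd : L'.PairwiseDisjoint id) (hA : ∀ t ∈ L', t ∩ A = ∅) (hE : E ⊆ A) (B : Set (ℙ K V)) :
    ((⋃₀ L' ∪ E) ∩ B).ncard = ∑ t ∈ L'.toFinite.toFinset, (t ∩ B).ncard + (E ∩ B).ncard := by
  rw [Set.union_inter_distrib_right, Set.ncard_union_eq, ncard_sUnion_inter hpd]
  refine Set.disjoint_left.2 fun X h1 h2 => ?_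
  obtain ⟨t, ht, hX⟩ := h1.1
  exact Set.notMem_empty X (hA t ht ▸ ⟨hX, hE h2.1⟩)

theorem cast_sum_eq_card_filter {ι : Type*} (q : ℕ) (F : Finset ι) (f : ι → ℕ) (c : ι → Prop)
    [DecidablePred c] (h1 : ∀ t ∈ F, c t → f t = 1) (h0 : ∀ t ∈ F, ¬ c t → q ∣ f t) :
    ((∑ t ∈ F, f t : ℕ) : ZMod q) = (F.filter c).card := by
  rw [Nat.cast_sum, ← Finset.sum_boole]
  refine Finset.sum_congr rfl fun t ht => ?_
  split_ifs with hc
  · rw [h1 t ht hc, Nat.cast_one]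
  · exact (ZMod.natCast_eq_zero_iff _ _).2 (h0 t ht hc)

omit [Finite K] in
theorem exists_hyperplane_mem_notMem {X Y : ℙ K V} (hXY : X ≠ Y) (hπ : IsHyperplaneOf π ⊤)
    (hX : X ∈ pts π) (hY : Y ∈ pts π) :
    ∃ ν : Submodule K V, IsHyperplaneOf ν π ∧ X ∈ pts ν ∧ Y ∉ pts ν := by
  have hYX : Y.rep ∉ K ∙ X.rep := fun h => hXY (by
    obtain ⟨c, hc⟩ := Submodule.mem_span_singleton.1 h
    rw [← Y.mk_rep]
    exact ((mk_eq_iff_exists_smul_rep _ _ _).2 ⟨c, hc⟩).symm)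
  obtain ⟨f, hfY, hfX⟩ := Submodule.exists_le_ker_of_notMem hYX
  simp only [mem_pts_iff_rep] at hX hY ⊢
  refine ⟨f.ker ⊓ π, (isHyperplaneOf_ker (by rintro rfl; simp at hfY)).inf hπ ?_,
    ⟨hfX (Submodule.mem_span_singleton_self _), hX⟩, fun h => hfY h.1⟩
  rintro rfl
  exact hfY hY

omit [Finite K] [Finite V] in
open Classical in
theorem ncard_inter_pts_of_subset_lineThrough {X Y : ℙ K V} (hXY : X ≠ Y) {E : Set (ℙ K V)}
    (hE : E ⊆ pts (lineThrough X Y)) {ν : Submodule K V} (hX : X ∈ pts ν) (hY : Y ∉ pts ν) :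
    (E ∩ pts ν).ncard = if X ∈ E then 1 else 0 := by
  have h : E ∩ pts ν = E ∩ {X} := by
    ext Z
    refine and_congr_right fun hZE => ⟨fun hZ => ?_, fun hZ => ?_⟩
    · by_contra hZX
      apply hY
      have h1 := eq_lineThrough (Ne.symm hZX) (finrank_lineThrough hXY)
        (left_mem_pts_lineThrough X Y) (hE hZE)
      have h2 : lineThrough X Y ≤ ν := h1 ▸ lineThrough_le hX hZ
      exact (right_mem_pts_lineThrough X Y).trans h2
    · rw [Set.mem_singleton_iff.1 hZ]
      exact hX
  rw [h]
  split_ifs with hXE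
  · rw [Set.inter_eq_right.2 (Set.singleton_subset_iff.2 hXE), Set.ncard_singleton]
  · rw [Set.inter_singleton_eq_empty.2 hXE, Set.ncard_empty]

omit [Finite K] [Finite V] in
theorem lineThrough_comm (X Y : ℙ K V) : lineThrough X Y = lineThrough Y X :=
  sup_comm _ _

/-- Both powers of q have positive exponent, so modulo q only -m + 1 = 0 is left, whatever ε is. -/
theorem natCast_eq_one_of_section {q m r : ℕ} {ε : ℤ}
    (h : ((q : ℤ) - 1) * m + 1 = (q : ℤ) ^ (2 * (r + 1)) + ε * (((q : ℤ) - 1) * (q : ℤ) ^ (r + 1))) :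
    (m : ZMod q) = 1 := by
  have h' := congrArg (Int.cast : ℤ → ZMod q) h
  push_cast [ZMod.natCast_self] at h'
  simp only [mul_add, ne_eq, Nat.add_eq_zero_iff, one_ne_zero, and_false, not_false_eq_true,
    zero_pow, mul_zero, add_zero] at h'
  simp at h'
  linear_combination -h'

/-- A set of truncated lines as in the switching theorem, with the prescribed intersection numbers
with the hyperplanes of `π` on `P` or `N`, has the right number of points, and meets the
hyperplanes of `π` missing `P` and `N` in the right number of points. -/
theorem IsTruncatedLineSet.ncard_sections [CharP K 2] (hL : IsTruncatedLineSet P N π L)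
    (hPN : P ≠ N) (hπ : IsHyperplaneOf π ⊤) (hPπ : P ∈ pts π) (hNπ : N ∈ pts π) {r : ℕ}
    (hcard : (Nat.card K - 1) * L.ncard + 1 = Nat.card K ^ (2 * (r + 1))) {S : Set (ℙ K V)}
    (hS : S = ⋃₀ L ∪ pts (lineThrough P N) ∨ S = ⋃₀ L ∪ {P} ∨ S = ⋃₀ L ∪ {N})
    (hsec : HasConelikeSections (r + 2) P N π S) :
    S ⊆ pts π ∧ S.ncard = Nat.card K * L.ncard + 1 ∧
      ∀ ν : Submodule K V, IsHyperplaneOf ν π → P ∉ pts ν → N ∉ pts ν →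
        (S ∩ pts ν).ncard = L.ncard := by
  classical
  obtain ⟨L', E, c, hsub, hLc, hpd, hdisj, rfl, hEA, hcases⟩ := hL.exists_decomposition hPN hS
  set A := pts (lineThrough P N) with hA
  have hAπ : A ⊆ pts π := fun X hX => hX.trans (lineThrough_le hPπ hNπ)
  have hcenter (t : Set (ℙ K V)) (ht : t ∈ L') : t ⊆ pts π ∧
      (IsTruncatedLine P t ∨ IsTruncatedLine N t) := hL.1 t (hsub ht)
  have hq : 1 < Nat.card K := Finite.one_lt_card
  set q := Nat.card K with hqdef
  have hone (ν : Submodule K V) (hν : IsHyperplaneOf ν π) (hPN' : P ∈ pts ν ∨ N ∈ pts ν) :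
      ((((⋃₀ L' ∪ E) ∩ pts ν).ncard : ℕ) : ZMod q) = 1 := by
    simp only [mem_pts_iff_rep] at hPN'
    obtain ⟨ε, -, hε⟩ := (hasConelikeSections_iff r P N π _).1 hsec ν hν hPN'
    rw [← vectorCone_pts, ← vectorCone_inter, int_ncard_vectorCone] at hε
    exact natCast_eq_one_of_section hε
  set F := L'.toFinite.toFinset with hF
  have hFmem (t : Set (ℙ K V)) : t ∈ F ↔ t ∈ L' := Set.Finite.mem_toFinset _
  have hFcard : F.card = L'.ncard := (Set.ncard_eq_toFinset_card _).symm
  have hcount := ncard_sUnion_union_inter hpd hdisj hEA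
  -- Test with a hyperplane through P missing N: lines through P contribute 0 modulo q, the others
  -- exactly 1, and of the points of E only P can lie on it. The next claim exchanges P and N.
  have hP1 : ((F.filter fun t => ¬ IsTruncatedLine P t).card : ZMod q) +
      ((if P ∈ E then 1 else 0 : ℕ) : ZMod q) = 1 := by
    obtain ⟨ν, hν, hPν, hNν⟩ := exists_hyperplane_mem_notMem hPN hπ hPπ hNπ
    rw [← hone ν hν (Or.inl hPν), hcount, Nat.cast_add,
      ncard_inter_pts_of_subset_lineThrough hPN hEA hPν hNν,
      cast_sum_eq_card_filter q _ _ (fun t => ¬ IsTruncatedLine P t)]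
    · intro t ht h
      have h' := hcenter t ((hFmem t).1 ht)
      exact (h'.2.resolve_left h).ncard_inter_of_notMem hν hNπ h'.1 hNν
    · intro t ht h
      exact (not_not.1 h).card_dvd_ncard_inter hPν
  have hN1 : ((F.filter fun t => IsTruncatedLine P t).card : ZMod q) +
      ((if N ∈ E then 1 else 0 : ℕ) : ZMod q) = 1 := by
    obtain ⟨ν, hν, hNν, hPν⟩ := exists_hyperplane_mem_notMem hPN.symm hπ hNπ hPπ
    rw [← hone ν hν (Or.inr hNν), hcount, Nat.cast_add,
      ncard_inter_pts_of_subset_lineThrough hPN.symm (lineThrough_comm P N ▸ hEA) hNν hPν,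
      cast_sum_eq_card_filter q _ _ (fun t => IsTruncatedLine P t)]
    · intro t ht h
      exact h.ncard_inter_of_notMem hν hPπ (hcenter t ((hFmem t).1 ht)).1 hPν
    · intro t ht h
      exact ((hcenter t ((hFmem t).1 ht)).2.resolve_left h).card_dvd_ncard_inter hNν
  have hL1 : (L.ncard : ZMod q) = 1 := by
    have h := congrArg (Nat.cast : ℕ → ℤ) hcard
    push_cast [hq.le] at h
    exact natCast_eq_one_of_section (ε := 0) (by rw [h]; ring)
  have hfilter := Finset.card_filter_add_card_filter_not (s := F) (fun t => IsTruncatedLine P t)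
  -- Adding the two congruences counts every line off PN once, and |L| ≡ 1.
  have hPNE : ((if P ∈ E then 1 else 0 : ℕ) : ZMod q) + ((if N ∈ E then 1 else 0 : ℕ) : ZMod q) =
      1 + c := by
    rw [hLc, ← hFcard, ← hfilter, Nat.cast_add, Nat.cast_add] at hL1
    linear_combination hP1 + hN1 - hL1
  have : Fact (1 < q) := ⟨hq⟩
  -- This excludes adding all of PN when no member lies on it, and a truncated PN whose missing
  -- point is not added back.
  have hfinal : (c = 0 ∧ (E = {P} ∨ E = {N})) ∨ (c = 1 ∧ E = A) := by
    have hPA : P ∈ A := left_mem_pts_lineThrough P N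
    have hNA : N ∈ A := right_mem_pts_lineThrough P N
    rcases hcases with ⟨hc, hE⟩ | ⟨hc, hE⟩
    · refine Or.inl ⟨hc, hE.resolve_left fun hE => ?_⟩
      subst hE hc
      simp [hPA, hNA] at hPNE
    · refine Or.inr ⟨hc, Set.Subset.antisymm hEA ?_⟩
      subst hc
      -- For q = 2 the congruence alone would allow both P and N to be missing; but E contains PN
      -- minus only one of them.
      have hPE : P ∈ E := by
        by_contra hPE
        have hNE : N ∈ E := by
          by_contra hNE
          rcases hE with hE | hE
          · exact hNE (hE ⟨hNA, hPN.symm⟩)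
          · exact hPE (hE ⟨hPA, hPN⟩)
        simp [hPE, hNE] at hPNE
      have hNE : N ∈ E := by
        by_contra hNE
        simp [hPE, hNE] at hPNE
      rcases hE with hE | hE
      · rwa [Set.sdiff_singleton_subset_iff, Set.insert_eq_of_mem hPE] at hE
      · rwa [Set.sdiff_singleton_subset_iff, Set.insert_eq_of_mem hNE] at hE
  have hSπ : ⋃₀ L' ∪ E ⊆ pts π :=
    Set.union_subset (Set.sUnion_subset fun t ht => (hcenter t ht).1) (hEA.trans hAπ)
  refine ⟨hSπ, ?_, ?_⟩
  · rw [← Set.inter_eq_left.2 hSπ, hcount, Set.inter_eq_left.2 (hEA.trans hAπ)]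
    have h1 : ∑ t ∈ F, (t ∩ pts π).ncard = L'.ncard * q := by
      rw [Finset.sum_const_nat (m := q), hFcard]
      intro t ht
      have h' := hcenter t ((hFmem t).1 ht)
      rw [Set.inter_eq_left.2 h'.1]
      rcases h'.2 with h | h <;> exact h.ncard_eq
    have h2 : E.ncard = c * q + 1 := by
      rcases hfinal with ⟨rfl, rfl | rfl⟩ | ⟨rfl, rfl⟩
      · simp
      · simp
      · rw [hA, ncard_pts_of_finrank_two (finrank_lineThrough hPN), one_mul]
    rw [h1, h2, hLc]
    ring
  · intro ν hν hPν hNν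
    rw [hcount]
    have h1 : ∑ t ∈ F, (t ∩ pts ν).ncard = L'.ncard := by
      rw [Finset.sum_const_nat (m := 1), hFcard, mul_one]
      intro t ht
      have h' := hcenter t ((hFmem t).1 ht)
      rcases h'.2 with h | h
      · exact h.ncard_inter_of_notMem hν hPπ h'.1 hPν
      · exact h.ncard_inter_of_notMem hν hNπ h'.1 hNν
    have h2 : (E ∩ pts ν).ncard = c := by
      rcases hfinal with ⟨rfl, rfl | rfl⟩ | ⟨rfl, rfl⟩
      · rw [Set.singleton_inter_eq_empty.2 hPν, Set.ncard_empty]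
      · rw [Set.singleton_inter_eq_empty.2 hNν, Set.ncard_empty]
      · have : A ∩ pts ν = pts (lineThrough P N ⊓ ν) := by
          ext X
          simp [A, pts]
        rw [this]
        exact ncard_pts_of_finrank_one (finrank_inf_of_isHyperplaneOf hν (finrank_lineThrough hPN)
          (lineThrough_le hPπ hNπ) fun h => hPν ((left_mem_pts_lineThrough P N).trans h))
    rw [h1, h2, hLc]

/-- The two parts of a hyperplane section never deviate together. For H through P or N the part
outside π is constant and ε comes from the trace on π; for H missing both, the trace is constant and
ε comes from Q. The hyperplane π itself gives ε = 0. -/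
theorem IsTangentHyperplane.isParabolicQuasiQuadric_switch [CharP K 2] {Q : QuadraticForm K V}
    (h : IsTangentHyperplane Q P.rep N.rep π) {r : ℕ}
    (hV : Module.finrank K V = 2 * (r + 1) + 3) (hPN : P ≠ N)
    (hL : IsTruncatedLineSet P N π L)
    (hcard : (Nat.card K - 1) * L.ncard + 1 = Nat.card K ^ (2 * (r + 1))) {S : Set (ℙ K V)}
    (hS : S = ⋃₀ L ∪ pts (lineThrough P N) ∨ S = ⋃₀ L ∪ {P} ∨ S = ⋃₀ L ∪ {N})
    (hsec : HasConelikeSections (r + 2) P N π S) :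
    IsParabolicQuasiQuadric (r + 2) ((quadric Q \ pts π) ∪ S) := by
  have hPπ : P ∈ pts π := (mem_pts_iff_rep _ _).2 h.vertex_mem
  have hNπ : N ∈ pts π := (mem_pts_iff_rep _ _).2 h.nucleus_mem
  obtain ⟨hSπ, hScard, hSν⟩ := hL.ncard_sections hPN h.isHyperplaneOf_top hPπ hNπ hcard hS hsec
  set S' := (quadric Q \ pts π) ∪ S with hS'
  have hoff : vectorCone S' \ π = {v | Q v = 0} \ π := by
    rw [← vectorCone_quadric]
    ext v
    refine and_congr_left fun hv => ?_
    have hv0 : v ≠ 0 := by rintro rfl; exact hv π.zero_mem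
    rw [mem_vectorCone_iff hv0, mem_vectorCone_iff hv0]
    have hvπ : Projectivization.mk K v hv0 ∉ pts π := fun hm => hv ((mk_mem_pts _ _ _).1 hm)
    simp only [S', Set.mem_union, Set.mem_sdiff, hvπ, not_false_eq_true, and_true, or_iff_left_iff_imp]
    exact fun hm => absurd (hSπ hm) hvπ
  have hon (W : Submodule K V) (hW : W ≤ π) : S' ∩ pts W = S ∩ pts W := by
    ext X
    refine and_congr_left fun hX => ?_
    have hXπ : X ∈ pts π := hX.trans hW
    simp [S', hXπ]
  have hvec (W : Submodule K V) (hW : W ≤ π) : ((vectorCone S' ∩ W : Set V).ncard : ℤ) =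
      ((Nat.card K : ℤ) - 1) * (S ∩ pts W).ncard + 1 := by
    rw [← vectorCone_pts, ← vectorCone_inter, hon W hW, int_ncard_vectorCone]
  have hcard' : ((Nat.card K : ℤ) - 1) * L.ncard + 1 = (Nat.card K : ℤ) ^ (2 * (r + 1)) := by
    have hq : 1 ≤ Nat.card K := Nat.card_pos
    have := congrArg (Nat.cast : ℕ → ℤ) hcard
    push_cast [hq] at this
    exact this
  refine (isParabolicQuasiQuadric_iff (r + 1) S').2 fun H hH => ?_
  by_cases hne : H = π
  · refine ⟨0, Or.inr (Or.inl rfl), ?_⟩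
    rw [hne, hvec π le_rfl, Set.inter_eq_left.2 hSπ, hScard]
    push_cast
    linear_combination (Nat.card K : ℤ) * hcard'
  have hν := hH.inf h.isHyperplaneOf_top hne
  rw [ncard_vectorCone_inter_of_eq_off hoff]
  by_cases hpn : P.rep ∈ H ∨ N.rep ∈ H
  · have hpn' : P.rep ∈ H ⊓ π ∨ N.rep ∈ H ⊓ π :=
      hpn.imp (fun h0 => ⟨h0, h.vertex_mem⟩) (fun h0 => ⟨h0, h.nucleus_mem⟩)
    obtain ⟨ε, hε, hc⟩ := (hasConelikeSections_iff r P N π S).1 hsec _ hν hpn'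
    refine ⟨ε, hε, ?_⟩
    rw [← vectorCone_pts, ← vectorCone_inter, int_ncard_vectorCone] at hc
    rw [h.ncard_zeros_diff_of_mem hV hH hne hpn, hvec _ inf_le_right, hc]
    ring
  · rw [not_or] at hpn
    obtain ⟨ε, hε, -, hc⟩ := h.ncard_zeros_diff_of_notMem hV hH hpn.1 hpn.2
    refine ⟨ε, by tauto, ?_⟩
    rw [hc, hvec _ inf_le_right, hSν _ hν (fun h0 => hpn.1 ((mem_pts_iff_rep _ _).1 h0).1)
      (fun h0 => hpn.2 ((mem_pts_iff_rep _ _).1 h0).1), hcard']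
    ring

end Converse

/-! ### The direct part: building the truncated lines. -/

section Direct

variable {K V : Type*} [Field K] [AddCommGroup V] [Module K V] {P N : ℙ K V} {π : Submodule K V}

theorem lineThrough_eq_of_mem {C X Y : ℙ K V} (hXC : C ≠ X)
    (hY : Y ∈ pts (lineThrough C X) \ {C}) : lineThrough C Y = lineThrough C X :=
  (eq_lineThrough (Ne.symm hY.2) (finrank_lineThrough hXC) (left_mem_pts_lineThrough C X)
    hY.1).symm

theorem exists_rep_eq_of_mem_truncated {C X Y : ℙ K V} (hY : Y ∈ pts (lineThrough C X) \ {C}) :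
    ∃ a b : K, b ≠ 0 ∧ Y.rep = b • X.rep + a • C.rep := by
  obtain ⟨a, b, hab⟩ := mem_lineThrough.1 ((mem_pts_iff_rep _ _).1 hY.1)
  refine ⟨a, b, ?_, by rw [← hab, add_comm]⟩
  rintro rfl
  apply hY.2
  rw [Set.mem_singleton_iff, ← Y.mk_rep]
  exact (mk_eq_iff_exists_smul_rep _ _ _).2 ⟨a, by simpa using hab⟩

theorem notMem_lineThrough_of_mem_truncated {A B C X Y : ℙ K V} (hAB : A ≠ B)
    (hC : C ∈ pts (lineThrough A B)) (hX : X ∉ pts (lineThrough A B))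
    (hY : Y ∈ pts (lineThrough C X) \ {C}) : Y ∉ pts (lineThrough A B) := by
  intro hYl
  have hCX : C ≠ X := fun h => hX (h ▸ hC)
  apply hX
  rw [eq_lineThrough (Ne.symm hY.2) (finrank_lineThrough hAB) hC hYl, lineThrough_eq_of_mem hCX hY]
  exact right_mem_pts_lineThrough C X

theorem IsRuled.mem_iff {T : Set V} (hT : ∀ c : K, c ≠ 0 → ∀ v, c • v ∈ T ↔ v ∈ T) {p n x : V}
    (h : IsRuled K T p n x) {a b : K} (hb : b ≠ 0) : b • x + a • p ∈ T ↔ x ∈ T := by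
  have h1 := h (b⁻¹ * a) 0
  rw [zero_smul, add_zero, add_zero, ← hT b hb, smul_add, smul_smul, mul_inv_cancel_left₀ hb] at h1
  exact h1

open Classical in
/-- The truncated line through `X` in the direction of `P` or `N` along which `T` is constant. -/
noncomputable def rulingLine (T : Set V) (P N X : ℙ K V) : Set (ℙ K V) :=
  if IsRuled K T P.rep N.rep X.rep then pts (lineThrough P X) \ {P}
  else pts (lineThrough N X) \ {N}

theorem self_mem_rulingLine (T : Set V) {X : ℙ K V} (hX : X ∉ pts (lineThrough P N)) :
    X ∈ rulingLine T P N X := by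
  unfold rulingLine
  split_ifs
  · exact ⟨right_mem_pts_lineThrough P X, fun h => hX (h ▸ left_mem_pts_lineThrough P N)⟩
  · exact ⟨right_mem_pts_lineThrough N X, fun h => hX (h ▸ right_mem_pts_lineThrough P N)⟩

theorem isTruncatedLine_rulingLine (T : Set V) {X : ℙ K V} (hX : X ∉ pts (lineThrough P N)) :
    IsTruncatedLine P (rulingLine T P N X) ∨ IsTruncatedLine N (rulingLine T P N X) := by
  unfold rulingLine
  split_ifs
  · exact Or.inl ⟨_, finrank_lineThrough (ne_of_mem_of_not_mem (left_mem_pts_lineThrough P N) hX),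
      left_mem_pts_lineThrough P X, rfl⟩
  · exact Or.inr ⟨_, finrank_lineThrough (ne_of_mem_of_not_mem (right_mem_pts_lineThrough P N) hX),
      left_mem_pts_lineThrough N X, rfl⟩

/-- Moving along a line through P or N changes the representative only by a scalar and a multiple of
p or n, so the ruling test has the same outcome at Y as at X. Thus ruling lines partition the points
off PN. -/
theorem rulingLine_spec {T : Set V} (hT : ∀ c : K, c ≠ 0 → ∀ v, c • v ∈ T ↔ v ∈ T)
    (hgrid : IsGridAdditive K T P.rep N.rep) (hPN : P ≠ N) {X Y : ℙ K V}
    (hX : X ∉ pts (lineThrough P N)) (hY : Y ∈ rulingLine T P N X) :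
    Y ∉ pts (lineThrough P N) ∧ (Y.rep ∈ T ↔ X.rep ∈ T) ∧
      rulingLine T P N Y = rulingLine T P N X := by
  have hP := left_mem_pts_lineThrough P N
  have hN := right_mem_pts_lineThrough P N
  by_cases hr : IsRuled K T P.rep N.rep X.rep
  · have hlX : rulingLine T P N X = pts (lineThrough P X) \ {P} := if_pos hr
    rw [hlX] at hY ⊢
    obtain ⟨a, b, hb, hab⟩ := exists_rep_eq_of_mem_truncated hY
    have hrY : IsRuled K T P.rep N.rep Y.rep := by
      have := (isRuled_smul_add_iff hT (n := N.rep) hb a 0).2 hr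
      rwa [zero_smul, add_zero, ← hab] at this
    refine ⟨notMem_lineThrough_of_mem_truncated hPN hP hX hY, hab ▸ hr.mem_iff hT hb, ?_⟩
    rw [rulingLine, if_pos hrY, lineThrough_eq_of_mem (ne_of_mem_of_not_mem hP hX) hY]
  · have hlX : rulingLine T P N X = pts (lineThrough N X) \ {N} := if_neg hr
    rw [hlX] at hY ⊢
    obtain ⟨a, b, hb, hab⟩ := exists_rep_eq_of_mem_truncated hY
    have hrY : ¬ IsRuled K T P.rep N.rep Y.rep := by
      intro hrY
      apply hr
      apply (isRuled_smul_add_iff hT (p := P.rep) (n := N.rep) hb 0 a).1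
      rwa [zero_smul, add_zero, ← hab]
    refine ⟨notMem_lineThrough_of_mem_truncated hPN hN hX hY,
      hab ▸ ((hgrid.isRuled_or X.rep).resolve_left hr).mem_iff hT hb, ?_⟩
    rw [rulingLine, if_neg hrY, lineThrough_eq_of_mem (ne_of_mem_of_not_mem hN hX) hY]

/-- The line `PN` is contained in a grid-additive cone or meets it in exactly one of `P`, `N`. -/
theorem IsGridAdditive.inter_lineThrough (hPN : P ≠ N) {S : Set (ℙ K V)}
    (hgrid : IsGridAdditive K (vectorCone S) P.rep N.rep) :
    pts (lineThrough P N) ⊆ S ∨ (S ∩ pts (lineThrough P N) = {P} ∧ N ∉ S) ∨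
      (S ∩ pts (lineThrough P N) = {N} ∧ P ∉ S) := by
  have key (X : ℙ K V) (hX : X ∈ pts (lineThrough P N)) (hXP : X ≠ P) (hXN : X ≠ N) :
      S.indicator (1 : ℙ K V → ℂ) X + 1 =
        S.indicator (1 : ℙ K V → ℂ) P + S.indicator (1 : ℙ K V → ℂ) N := by
    obtain ⟨a, b, hab⟩ := mem_lineThrough.1 ((mem_pts_iff_rep _ _).1 hX)
    have ha : a ≠ 0 := by
      rintro rfl
      apply hXN
      rw [← X.mk_rep]
      exact (mk_eq_iff_exists_smul_rep _ _ _).2 ⟨b, by simpa using hab⟩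
    have hb : b ≠ 0 := by
      rintro rfl
      apply hXP
      rw [← X.mk_rep]
      exact (mk_eq_iff_exists_smul_rep _ _ _).2 ⟨a, by simpa using hab⟩
    -- The base point 0 belongs to every vector cone by convention; this is the source of the
    -- summand 1.
    have h := hgrid 0 a b
    rw [zero_add, zero_add, hab] at h
    have hind (c : K) (hc : c ≠ 0) (Y : ℙ K V) : (vectorCone S).indicator (1 : V → ℂ) (c • Y.rep) =
        S.indicator (1 : ℙ K V → ℂ) Y := by
      have hiff : c • Y.rep ∈ vectorCone S ↔ Y ∈ S := by
        rw [smul_mem_vectorCone_iff S hc, rep_mem_vectorCone_iff]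
      by_cases hY : Y ∈ S
      · rw [Set.indicator_of_mem hY, Set.indicator_of_mem (hiff.2 hY)]
        rfl
      · rw [Set.indicator_of_notMem hY, Set.indicator_of_notMem (fun h => hY (hiff.1 h))]
    have h1 := hind 1 one_ne_zero X
    rw [one_smul] at h1
    rwa [hind a ha, hind b hb, h1, Set.indicator_of_mem (zero_mem_vectorCone S)] at h
  obtain ⟨D, hDl, hDP, hDN⟩ := exists_mem_lineThrough_ne hPN
  have hD := key D hDl hDP hDN
  have hPl := left_mem_pts_lineThrough P N
  have hNl := right_mem_pts_lineThrough P N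
  by_cases hP : P ∈ S <;> by_cases hN : N ∈ S
  · left
    intro X hX
    by_contra hXS
    have := key X hX (fun h => hXS (h ▸ hP)) (fun h => hXS (h ▸ hN))
    simp [Set.indicator, hXS, hP, hN] at this
  · refine Or.inr (Or.inl ⟨?_, hN⟩)
    ext X
    refine ⟨fun hX => ?_, fun hX => by rw [Set.mem_singleton_iff.1 hX]; exact ⟨hP, hPl⟩⟩
    by_contra hXP
    have := key X hX.2 hXP (fun h => hN (h ▸ hX.1))
    simp [Set.indicator, hX.1, hP, hN] at this
  · refine Or.inr (Or.inr ⟨?_, hP⟩)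
    ext X
    refine ⟨fun hX => ?_, fun hX => by rw [Set.mem_singleton_iff.1 hX]; exact ⟨hN, hNl⟩⟩
    by_contra hXN
    have := key X hX.2 (fun h => hP (h ▸ hX.1)) hXN
    simp [Set.indicator, hX.1, hP, hN] at this
  · by_cases hDS : D ∈ S <;> norm_num [Set.indicator, hDS, hP, hN] at hD

/-- The ruling lines of the points of S off PN are pairwise disjoint and have q points each. If PN
lies in S, its truncation at P joins them as one more member, so that |S| = q|L| + 1 in all three
cases and |L| follows from |S|. -/
theorem exists_truncatedLineSet [Finite K] [Finite V] (hPN : P ≠ N) (hPπ : P ∈ pts π)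
    (hNπ : N ∈ pts π) {S : Set (ℙ K V)} (hSπ : S ⊆ pts π)
    (hgrid : IsGridAdditive K (vectorCone S) P.rep N.rep) {d : ℕ}
    (hcard : (vectorCone S).ncard = Nat.card K ^ (d + 1)) :
    ∃ L : Set (Set (ℙ K V)), IsTruncatedLineSet P N π L ∧
      (Nat.card K - 1) * L.ncard + 1 = Nat.card K ^ d ∧
        ((S = ⋃₀ L ∪ pts (lineThrough P N) ∧
            (pts (lineThrough P N) \ {P} ∈ L ∨ pts (lineThrough P N) \ {N} ∈ L)) ∨
          (S = ⋃₀ L ∪ {P} ∧ N ∉ S) ∨ (S = ⋃₀ L ∪ {N} ∧ P ∉ S)) := by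
  have hT : ∀ c : K, c ≠ 0 → ∀ v, c • v ∈ vectorCone S ↔ v ∈ vectorCone S :=
    fun c hc v => smul_mem_vectorCone_iff S hc v
  set A := pts (lineThrough P N) with hA
  have hPA : P ∈ A := left_mem_pts_lineThrough P N
  have hNA : N ∈ A := right_mem_pts_lineThrough P N
  have hAπ : A ⊆ pts π := fun X hX => hX.trans (lineThrough_le hPπ hNπ)
  set L' := rulingLine (vectorCone S) P N '' (S \ A) with hL'
  have hspec (X : ℙ K V) (hX : X ∈ S \ A) (Y : ℙ K V) (hY : Y ∈ rulingLine (vectorCone S) P N X) :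
      Y ∈ S \ A ∧ rulingLine (vectorCone S) P N Y = rulingLine (vectorCone S) P N X := by
    obtain ⟨h1, h2, h3⟩ := rulingLine_spec hT hgrid hPN hX.2 hY
    rw [rep_mem_vectorCone_iff, rep_mem_vectorCone_iff] at h2
    exact ⟨⟨h2.2 hX.1, h1⟩, h3⟩
  have hsub : ∀ t ∈ L', t ⊆ S \ A := by
    rintro _ ⟨X, hX, rfl⟩ Y hY
    exact (hspec X hX Y hY).1
  have hU : ⋃₀ L' = S \ A := by
    refine Set.Subset.antisymm (Set.sUnion_subset hsub) fun X hX => ?_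
    exact ⟨_, ⟨X, hX, rfl⟩, self_mem_rulingLine _ hX.2⟩
  have heq : ∀ t ∈ L', ∀ Y ∈ t, t = rulingLine (vectorCone S) P N Y := by
    rintro _ ⟨X, hX, rfl⟩ Y hY
    exact (hspec X hX Y hY).2.symm
  have hpd : L'.PairwiseDisjoint id := fun s hs t ht hst =>
    Set.disjoint_left.2 fun Y hYs hYt => hst ((heq s hs Y hYs).trans (heq t ht Y hYt).symm)
  have htr : ∀ t ∈ L', t ⊆ pts π ∧ (IsTruncatedLine P t ∨ IsTruncatedLine N t) := by
    intro t ht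
    refine ⟨(hsub t ht).trans (Set.sdiff_subset.trans hSπ), ?_⟩
    obtain ⟨X, hX, rfl⟩ := ht
    exact isTruncatedLine_rulingLine _ hX.2
  have hcount : (S \ A).ncard = L'.ncard * Nat.card K := by
    have h := ncard_sUnion_inter hpd Set.univ
    rw [Set.inter_univ, hU] at h
    rw [h, Finset.sum_const_nat (m := Nat.card K), ← Set.ncard_eq_toFinset_card]
    intro t ht
    rw [Set.inter_univ]
    rcases (htr t ((Set.Finite.mem_toFinset _).1 ht)).2 with h | h <;> exact h.ncard_eq
  have hset' : IsTruncatedLineSet P N π L' :=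
    ⟨htr, fun s hs t ht hst => (Set.disjoint_iff_inter_eq_empty.1 (hpd hs ht hst)).subset.trans
      (Set.empty_subset _)⟩
  have hSA := Set.ncard_inter_add_ncard_sdiff_eq_ncard S A (Set.toFinite _)
  have hdecomp : S = ⋃₀ L' ∪ (S ∩ A) := by rw [hU, Set.sdiff_union_inter]
  rw [← card_sub_one_mul_ncard_add_one] at hcard
  have hcard' (l : ℕ) (hl : S.ncard = l * Nat.card K + 1) :
      (Nat.card K - 1) * l + 1 = Nat.card K ^ d := by
    have hq : 0 < Nat.card K := Nat.card_pos
    apply Nat.eq_of_mul_eq_mul_left hq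
    rw [hl] at hcard
    obtain ⟨m, hm⟩ := Nat.exists_eq_add_of_lt hq
    rw [hm] at hcard ⊢
    simp only [zero_add, Nat.add_sub_cancel] at hcard ⊢
    rw [← pow_succ', ← hcard]
    ring
  rcases hgrid.inter_lineThrough hPN with h | ⟨h, hN⟩ | ⟨h, hP⟩
  · have hSA' : S ∩ A = A := Set.inter_eq_right.2 h
    have hnot : A \ {P} ∉ L' := fun hm => (hsub _ hm ⟨hNA, hPN.symm⟩).2 hNA
    refine ⟨insert (A \ {P}) L', ⟨?_, ?_⟩, ?_, Or.inl ⟨?_, Or.inl (Set.mem_insert _ _)⟩⟩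
    · rintro t (rfl | ht)
      · exact ⟨Set.sdiff_subset.trans hAπ, Or.inl ⟨_, finrank_lineThrough hPN, hPA, rfl⟩⟩
      · exact htr t ht
    · have hdisj : ∀ t ∈ L', t ∩ (A \ {P}) = ∅ := fun t ht =>
        Set.disjoint_iff_inter_eq_empty.1 (Set.disjoint_left.2 fun X h1 h2 => (hsub t ht h1).2 h2.1)
      rintro s (rfl | hs) t (rfl | ht) hst
      · exact absurd rfl hst
      · rw [Set.inter_comm, hdisj t ht]
        exact Set.empty_subset _
      · rw [hdisj s hs]
        exact Set.empty_subset _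
      · exact hset'.2 s hs t ht hst
    · rw [Set.ncard_insert_of_notMem hnot (Set.toFinite _)]
      apply hcard'
      rw [← hSA, hcount, hSA', hA, ncard_pts_of_finrank_two (finrank_lineThrough hPN)]
      ring
    · rw [Set.sUnion_insert, Set.union_right_comm, Set.union_eq_right.2 Set.sdiff_subset,
        Set.union_comm]
      rwa [hSA'] at hdecomp
  · refine ⟨L', hset', hcard' _ ?_, Or.inr (Or.inl ⟨h ▸ hdecomp, hN⟩)⟩
    rw [← hSA, hcount, h, Set.ncard_singleton, add_comm]
  · refine ⟨L', hset', hcard' _ ?_, Or.inr (Or.inr ⟨h ▸ hdecomp, hP⟩)⟩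
    rw [← hSA, hcount, h, Set.ncard_singleton, add_comm]

end Direct

/-! ### The switching theorem. -/

theorem IsTangentHyperplane.rep_ne {K V : Type*} [Field K] [AddCommGroup V] [Module K V]
    {Q : QuadraticForm K V} {P N : ℙ K V} {π : Submodule K V}
    (h : IsTangentHyperplane Q P.rep N.rep π) : P ≠ N := by
  rintro rfl
  exact h.map_nucleus h.map_vertex

theorem IsSwitching.vectorCone_sdiff_eq {K V : Type*} [Field K] [AddCommGroup V] [Module K V]
    {Q : QuadraticForm K V} {S : Set (ℙ K V)} {π : Submodule K V}
    (h : IsSwitching (quadric Q) S π) : vectorCone S \ π = {v | Q v = 0} \ π := by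
  obtain ⟨R, R', hR, hR', rfl⟩ := h
  rw [← vectorCone_quadric]
  ext v
  refine and_congr_left fun hv => ?_
  have hv0 : v ≠ 0 := by rintro rfl; exact hv π.zero_mem
  have hvπ : Projectivization.mk K v hv0 ∉ pts π := fun hm => hv ((mk_mem_pts _ _ _).1 hm)
  rw [mem_vectorCone_iff hv0, mem_vectorCone_iff hv0, Set.mem_union, Set.mem_sdiff]
  have h1 : Projectivization.mk K v hv0 ∉ R := fun hm => hvπ (hR hm)
  have h2 : Projectivization.mk K v hv0 ∉ R' := fun hm => hvπ (hR' hm)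
  tauto

theorem mainTheorem6 {K V : Type*} [Field K] [Finite K] [AddCommGroup V] [Module K V]
    (q : ℕ) (hqK : Nat.card K = q) (hq : Even q) (n : ℕ) (hn : 2 ≤ n)
    (hV : Module.finrank K V = 2 * n + 1)
    (Q : QuadraticForm K V) (hQ : IsNonsingularForm Q)
    (N : ℙ K V) (hN : IsNucleus (quadric Q) N)
    (π : Submodule K V) (P : ℙ K V) (hπ : IsSingularHyperplane Q π P) :
    (∀ S' : Set (ℙ K V), IsSwitching (quadric Q) S' π →
      IsParabolicQuasiQuadric n S' → S'.ncard = (quadric Q).ncard →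
      (∃ L : Set (Set (ℙ K V)), IsTruncatedLineSet P N π L ∧
        L.ncard = (q ^ (2 * n - 2) - 1) / (q - 1) ∧
        ((S' ∩ pts π = ⋃₀ L ∪ pts (lineThrough P N) ∧
            (pts (lineThrough P N) \ {P} ∈ L ∨ pts (lineThrough P N) \ {N} ∈ L)) ∨
          (S' ∩ pts π = ⋃₀ L ∪ {P} ∧ N ∉ S') ∨
          (S' ∩ pts π = ⋃₀ L ∪ {N} ∧ P ∉ S'))) ∧
      HasConelikeSections n P N π S') ∧
    (∀ (L : Set (Set (ℙ K V))) (S : Set (ℙ K V)), IsTruncatedLineSet P N π L →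
      L.ncard = (q ^ (2 * n - 2) - 1) / (q - 1) →
      (S = ⋃₀ L ∪ pts (lineThrough P N) ∨ S = ⋃₀ L ∪ {P} ∨ S = ⋃₀ L ∪ {N}) →
      HasConelikeSections n P N π S →
      IsParabolicQuasiQuadric n ((quadric Q \ pts π) ∪ S)) := by
  subst hqK
  obtain ⟨r, rfl⟩ := Nat.exists_eq_add_of_le' hn
  have : FiniteDimensional K V := Module.finite_of_finrank_pos (by omega)
  have : Finite V := Module.finite_of_finite K
  have : CharP K 2 := by
    have := Fintype.ofFinite K
    refine ringChar.of_eq (FiniteField.even_card_iff_char_two.2 ?_)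
    rw [← Nat.card_eq_fintype_card]
    exact Nat.even_iff.1 hq
  have h := hπ.isTangentHyperplane hQ hN
  have hPπ : P ∈ pts π := (mem_pts_iff_rep _ _).2 h.vertex_mem
  have hNπ : N ∈ pts π := (mem_pts_iff_rep _ _).2 h.nucleus_mem
  have hV' : Module.finrank K V = 2 * (r + 1) + 3 := by rw [hV]; ring
  have hq1 : 0 < Nat.card K - 1 := Nat.sub_pos_of_lt Finite.one_lt_card
  have hexp : 2 * (r + 2) - 2 = 2 * (r + 1) := by omega
  -- The division of natural numbers is exact, because q - 1 divides q^k - 1.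
  have hcardL (m : ℕ) : m = (Nat.card K ^ (2 * (r + 2) - 2) - 1) / (Nat.card K - 1) ↔
      (Nat.card K - 1) * m + 1 = Nat.card K ^ (2 * (r + 1)) := by
    have hdvd : Nat.card K - 1 ∣ Nat.card K ^ (2 * (r + 1)) - 1 := by
      simpa using Nat.sub_dvd_pow_sub_pow (Nat.card K) 1 (2 * (r + 1))
    have hpos : 0 < Nat.card K ^ (2 * (r + 1)) := Nat.pow_pos Nat.card_pos
    rw [hexp, eq_comm, Nat.div_eq_iff_eq_mul_right hq1 hdvd]
    omega
  refine ⟨fun S' hsw hqq hcard => ?_, fun L S hL hLc hS hsec =>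
    h.isParabolicQuasiQuadric_switch hV' h.rep_ne hL ((hcardL _).1 hLc) hS hsec⟩
  have hoff := hsw.vectorCone_sdiff_eq
  have hvec : vectorCone (S' ∩ pts π) = vectorCone S' ∩ (π : Set V) := by
    rw [vectorCone_inter, vectorCone_pts]
  constructor
  · have hgrid := h.isGridAdditive hV' hoff hqq hcard
    rw [← hvec] at hgrid
    have hcard' : (vectorCone (S' ∩ pts π)).ncard = Nat.card K ^ (2 * (r + 1) + 1) := by
      rw [hvec, ncard_vectorCone_inter_eq_of_eq_off hoff hcard,
        h.ncard_zeros_of_nucleus_mem h.nucleus_mem (h.finrank_eq hV')]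
    obtain ⟨L, hL, hLc, hcases⟩ :=
      exists_truncatedLineSet h.rep_ne hPπ hNπ Set.inter_subset_right hgrid hcard'
    refine ⟨L, hL, (hcardL _).2 hLc, hcases.imp id (Or.imp ?_ ?_)⟩
    · exact fun h1 => ⟨h1.1, fun h2 => h1.2 ⟨h2, hNπ⟩⟩
    · exact fun h1 => ⟨h1.1, fun h2 => h1.2 ⟨h2, hPπ⟩⟩
  · exact (hasConelikeSections_iff r P N π S').2 fun ν hν hpn =>
      h.ncard_inter_of_mem hV' hoff hqq hν hpn
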